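/- Let $\Pi$ be a homogeneous Poisson process of intensity $r>0$ on $\mathbb{R}$, with point-set $[\Pi]=\{x:\Pi(\{x\})>0\}$, and let $\mu$ be a probability measure on the strictly positive integers with $\mu(\{k\})>0$ for some odd $k$. Let $\xi$ be a random integer-valued measure on $\mathbb{R}$ with the same support as $\Pi$ which, conditionally on $\Pi$, assigns i.i.d. values $D_x=\xi(\{x\})$ with law $\mu$ to the points $x\in[\Pi]$. Let $\mathcal{M}$ be a point process on the space of unordered pairs of real numbers, defined on the same probability space, such that - almost surely, for every pair $\{x,y\}\in[\mathcal{M}]$ we have $x,y\in[\Pi]$, and in the graph with vertex set $[\Pi]$ and edge set $[\mathcal{M}]$ each vertex $x$ has degree $D_x$ ($\mathcal{M}$ is a matching scheme); - almost surely, this graph has no self-loops and no multiple edges ($\mathcal{M}$ is simple); - the law of $\mathcal{M}$ is invariant under all translations of $\mathbb{R}$; - $\mathcal{M}$ is almost surely equal to a deterministic measurable function of $(\Pi,\xi)$ ($\mathcal{M}$ is a factor). Then almost surely there are infinitely many edges $\{x,y\}\in[\mathcal{M}]$ that cross the origin, that is, with $x<0<y$. -/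

import Mathlib

open MeasureTheory ProbabilityTheory
open scoped ENNReal NNReal

namespace PoissonMatching

/-- A locally finite integer-valued measure: every measurable set contained in a compact set has
a measure which is a (finite) natural number. -/
def IsPointMeasure {E : Type*} [TopologicalSpace E] [MeasurableSpace E] (m : Measure E) : Prop :=
  ∀ A : Set E, MeasurableSet A → ∀ K : Set E, IsCompact K → A ⊆ K → ∃ n : ℕ, m A = n

/-- The point-set `[m] = {x : m {x} > 0}` of a measure. -/
def points {E : Type*} [MeasurableSpace E] (m : Measure E) : Set E :=
  {x | 0 < m {x}}

/-- A point process on `E`: a random measure (for the σ-algebra on measures generated by the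
evaluations at measurable sets) which is almost surely locally finite and integer-valued. -/
structure IsPointProcess {Ω E : Type*} [MeasurableSpace Ω] [TopologicalSpace E]
    [MeasurableSpace E] (N : Ω → Measure E) (P : Measure Ω) : Prop where
  measurable : Measurable N
  isPointMeasure : ∀ᵐ ω ∂P, IsPointMeasure (N ω)

/-- A homogeneous Poisson process of intensity `r` on the real line. -/
structure IsPoissonProcess {Ω : Type*} [MeasurableSpace Ω] (r : ℝ≥0) (N : Ω → Measure ℝ)
    (P : Measure Ω) : Prop where
  isPointProcess : IsPointProcess N P
  /-- The number of points in `A` is Poisson distributed with mean `r` times the length of `A`. -/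
  hasLaw : ∀ A : Set ℝ, MeasurableSet A → volume A ≠ ∞ →
    HasLaw (fun ω => N ω A)
      ((poissonMeasure (r * (volume A).toNNReal)).map (fun n : ℕ => (n : ℝ≥0∞))) P
  /-- The numbers of points in pairwise disjoint sets are independent. -/
  indep : ∀ (n : ℕ) (A : Fin n → Set ℝ), (∀ i, MeasurableSet (A i)) →
    (∀ i j, i ≠ j → Disjoint (A i) (A j)) → iIndepFun (fun i ω => N ω (A i)) P

/-- `ξ` is a mark process for the point process `N` (with infinitely many points) which,
conditionally on `N`, assigns i.i.d. marks with law `μ` to the points of `N`. Here the mark of a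
point `x` is `ξ {x}`. Conditional independence is expressed through an enumeration `X 0, X 1, …` of
the points as a measurable function of `N`: the marks `D n` of the points `X n` are i.i.d. with
law `μ`, and the sequence `D` is independent of `N`. -/
structure IsIIDMarking {Ω : Type*} [MeasurableSpace Ω] (μ : Measure ℕ) (N ξ : Ω → Measure ℝ)
    (P : Measure Ω) : Prop where
  isPointProcess : IsPointProcess ξ P
  points_eq : ∀ᵐ ω ∂P, points (ξ ω) = points (N ω)
  exists_enumeration : ∃ (X : ℕ → Measure ℝ → ℝ) (D : ℕ → Ω → ℕ),
    (∀ n, Measurable (X n)) ∧ (∀ n, Measurable (D n)) ∧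
    (∀ᵐ ω ∂P, Function.Injective (fun n => X n (N ω)) ∧
      Set.range (fun n => X n (N ω)) = points (N ω)) ∧
    (∀ᵐ ω ∂P, ∀ n, ξ ω {X n (N ω)} = D n ω) ∧
    (∀ n, HasLaw (D n) μ P) ∧ iIndepFun D P ∧ IndepFun N (fun ω n => D n ω) P

/-- A matching scheme for `(N, ξ)`: a point process `M` on the space `Sym2 ℝ` of unordered pairs of
real numbers (the edges, with multiplicity) such that almost surely both end points of every edge
are points of `N`, and every point `x` of `N` has degree `ξ {x}`, self-loops being counted twice.
The space `Sym2 ℝ` carries the quotient topology and the quotient σ-algebra from `ℝ × ℝ`. -/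
structure IsMatchingScheme {Ω : Type*} [MeasurableSpace Ω] (N ξ : Ω → Measure ℝ)
    (M : Ω → Measure (Sym2 ℝ)) (P : Measure Ω) : Prop where
  isPointProcess : IsPointProcess M P
  endpoints : ∀ᵐ ω ∂P, ∀ e ∈ points (M ω), ∀ x ∈ e, x ∈ points (N ω)
  degree : ∀ᵐ ω ∂P, ∀ x ∈ points (N ω), M ω {e | x ∈ e} + M ω {s(x, x)} = ξ ω {x}

/-- The matching scheme is simple: almost surely no self-loops and no multiple edges. -/
def IsSimple {Ω : Type*} [MeasurableSpace Ω] (M : Ω → Measure (Sym2 ℝ)) (P : Measure Ω) : Prop :=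
  ∀ᵐ ω ∂P, ∀ e ∈ points (M ω), ¬ e.IsDiag ∧ M ω {e} = 1

/-- The law of `M` is invariant under all translations of the real line. -/
def IsTranslationInvariant {Ω : Type*} [MeasurableSpace Ω] (M : Ω → Measure (Sym2 ℝ))
    (P : Measure Ω) : Prop :=
  ∀ t : ℝ, P.map (fun ω => (M ω).map (Sym2.map (fun x => x + t))) = P.map M

/-- `M` is a (measurable) deterministic function of `N` and `ξ`, almost surely. -/
def IsFactor {Ω : Type*} [MeasurableSpace Ω] (N ξ : Ω → Measure ℝ) (M : Ω → Measure (Sym2 ℝ))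
    (P : Measure Ω) : Prop :=
  ∃ F : Measure ℝ × Measure ℝ → Measure (Sym2 ℝ), Measurable F ∧ ∀ᵐ ω ∂P, M ω = F (N ω, ξ ω)

/-- The edge `e` crosses the site `z`: its end points `x`, `y` satisfy `x < z < y`. -/
def Crosses (e : Sym2 ℝ) (z : ℝ) : Prop :=
  ∃ x y : ℝ, e = s(x, y) ∧ x < z ∧ z < y

end PoissonMatching

/-! Let `cut z` count the edges with left end below `z` and right end at or above `z`. Passing from
`0` to `T`, an edge enters the cut at its left end and leaves it at its right end, so if `cut 0` is
finite then so is `cut T`, and `cut 0 + cut T + ξ [0, T)` is even (`cut_add_degreeMeasure`,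
`parity_cut_mul`). With the convention that infinity has parity `0`, the product of the three
parities is the indicator of `cut 0 < ∞`.

Because `M` is a factor, the parity of `cut 0` is within a small `L¹` error `δ` of a function `g` of
the marks in `[-n, n)` (`IsIIDMarking.exists_tendsto_localMass`). The degrees of `M` are the marks
(`degreeMeasure_eq`), so invariance of the law of `M` gives the same error at `T`, with `g` read
from the marks in `[T - n, T + n)`. The remaining factor, the parity of the marks in `[n, T - n)`,
is independent of all this, and its mean is at most `exp (r (T - 2n) (Re φ(π) - 1))` in absolute
value, where `φ` is the characteristic function of `μ`. An odd atom of `μ` gives `Re φ(π) < 1`, so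
letting `T → ∞` yields `P (cut 0 < ∞) ≤ 2δ` (`measureReal_cut_le`), and then `δ → 0`
(`ae_cut_eq_top`).

The probabilistic inputs are the independence of the marks over disjoint sets, obtained from their
joint characteristic function, and the approximation by dyadic masses, obtained from martingale
convergence. -/

namespace PoissonMatching

/-! ### Atoms and integrality of point measures. -/

section PointMeasure

variable {E : Type*} [TopologicalSpace E] [MeasurableSpace E]

/-- The masses along a compact exhaustion are integers, increasing and bounded, so their supremum is
attained. -/
theorem IsPointMeasure.exists_nat [SigmaCompactSpace E] [T2Space E] [OpensMeasurableSpace E]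
    {m : Measure E} (hm : IsPointMeasure m) {A : Set E} (hA : MeasurableSet A) (h : m A ≠ ∞) :
    ∃ n : ℕ, m A = n := by
  have hK : ∀ k, ∃ n : ℕ, m (A ∩ compactCovering E k) = n := fun k =>
    hm _ (hA.inter (isCompact_compactCovering E k).isClosed.measurableSet) _
      (isCompact_compactCovering E k) Set.inter_subset_right
  choose f hf using hK
  have hmono : Monotone fun k => A ∩ compactCovering E k := fun i j hij =>
    Set.inter_subset_inter_right _ (compactCovering_subset E hij)
  have hsup : m A = ⨆ k, (f k : ℝ≥0∞) := by
    simp_rw [← hf]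
    rw [← hmono.measure_iUnion, ← Set.inter_iUnion, iUnion_compactCovering, Set.inter_univ]
  have hbdd : BddAbove (Set.range f) := by
    obtain ⟨b, hb⟩ := ENNReal.exists_nat_gt h
    refine ⟨b, ?_⟩
    rintro _ ⟨k, rfl⟩
    have : (f k : ℝ≥0∞) < b := (le_iSup (fun k => (f k : ℝ≥0∞)) k).trans_lt (hsup ▸ hb)
    exact_mod_cast this.le
  obtain ⟨k, hk⟩ := Nat.sSup_mem (Set.range_nonempty f) hbdd
  refine ⟨f k, hsup.trans (le_antisymm (iSup_le fun i => ?_) (le_iSup (fun k => (f k : ℝ≥0∞)) k))⟩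
  rw [hk]
  exact_mod_cast le_csSup hbdd ⟨i, rfl⟩

theorem IsPointMeasure.isFiniteMeasureOnCompacts [T2Space E] [OpensMeasurableSpace E]
    {m : Measure E} (hm : IsPointMeasure m) : IsFiniteMeasureOnCompacts m where
  lt_top_of_isCompact K hK := by
    obtain ⟨n, hn⟩ := hm K hK.isClosed.measurableSet K hK subset_rfl
    simp [hn]

theorem IsPointMeasure.countable_points [SigmaCompactSpace E] [T2Space E] [OpensMeasurableSpace E]
    {m : Measure E} (hm : IsPointMeasure m) : (points m).Countable := by
  have := hm.isFiniteMeasureOnCompacts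
  exact Measure.countable_meas_pos_of_disjoint_iUnion (fun x => measurableSet_singleton x)
    (fun x y h => by simpa using h)

/-- By outer regularity a point without mass has an open neighbourhood of mass less than `1`. A
compact neighbourhood inside it has integer mass, hence mass zero, so the complement of the atoms is
locally null. -/
theorem IsPointMeasure.measure_compl_points [SigmaCompactSpace E] [T2Space E]
    [SecondCountableTopology E] [LocallyCompactSpace E] [BorelSpace E]
    [TopologicalSpace.PseudoMetrizableSpace E]
    {m : Measure E} (hm : IsPointMeasure m) : m (points m)ᶜ = 0 := by
  have := hm.isFiniteMeasureOnCompacts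
  refine measure_null_of_locally_null _ fun x hx => ?_
  have hx0 : m {x} = 0 := by simpa [points] using hx
  obtain ⟨U, hxU, hUo, hU⟩ := Set.exists_isOpen_lt_of_lt {x} (1 : ℝ≥0∞) (μ := m) (by simp [hx0])
  obtain ⟨K, hK, hxK, hKU⟩ := exists_compact_subset hUo (hxU rfl)
  refine ⟨K, mem_nhdsWithin_of_mem_nhds (mem_interior_iff_mem_nhds.1 hxK), ?_⟩
  obtain ⟨n, hn⟩ := hm K hK.isClosed.measurableSet K hK subset_rfl
  have h1 : (n : ℝ≥0∞) < 1 := hn ▸ (measure_mono hKU).trans_lt hU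
  have : n = 0 := by
    have : n < 1 := by exact_mod_cast h1
    omega
  simp [hn, this]

end PointMeasure

theorem measure_eq_tsum_of_enumeration {E : Type*} [MeasurableSpace E] [MeasurableSingletonClass E]
    {m : Measure E} {X : ℕ → E} (hX : Function.Injective X) (hm : m (Set.range X)ᶜ = 0) (B : Set E) :
    m B = ∑' n, B.indicator (fun x => m {x}) (X n) := by
  classical
  have h1 : m B = m (B ∩ Set.range X) := (measure_inter_conull hm).symm
  have h2 : B ∩ Set.range X = ⋃ n, ({X n} ∩ B) := by
    ext x
    simp only [Set.mem_inter_iff, Set.mem_range, Set.mem_iUnion, Set.mem_singleton_iff]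
    constructor
    · rintro ⟨h, n, rfl⟩
      exact ⟨n, rfl, h⟩
    · rintro ⟨n, rfl, h⟩
      exact ⟨h, n, rfl⟩
  have h3 : ∀ n, MeasurableSet ({X n} ∩ B) := fun n =>
    ((Set.finite_singleton (X n)).inter_of_left B).measurableSet
  rw [h1, h2, measure_iUnion _ h3]
  · congr with n
    by_cases h : X n ∈ B
    · simp [h, Set.inter_eq_left.2 (Set.singleton_subset_iff.2 h)]
    · simp [h, Set.singleton_inter_eq_empty.2 h]
  · intro i j hij
    refine Set.disjoint_left.2 fun x hx hx' => hij (hX ?_)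
    exact hx.1.symm.trans hx'.1

theorem measure_eq_of_singleton_eq {E : Type*} [MeasurableSpace E] [MeasurableSingletonClass E]
    {m m' : Measure E} {S : Set E} (hS : S.Countable) (hm : m Sᶜ = 0) (hm' : m' Sᶜ = 0)
    (h : ∀ x ∈ S, m {x} = m' {x}) : m = m' := by
  ext A hA
  have key : ∀ ν : Measure E, ν Sᶜ = 0 → ν A = ∑' x : (A ∩ S : Set E), ν {(x : E)} := by
    intro ν hν
    rw [← measure_inter_conull hν, ← measure_biUnion (hS.mono Set.inter_subset_right)
      (fun x _ y _ h => by simpa using h) (fun x _ => measurableSet_singleton x),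
      Set.biUnion_of_singleton]
  rw [key m hm, key m' hm']
  exact tsum_congr fun x => h x x.2.2

theorem IsPointMeasure.measure_Ico_lt_top {m : Measure ℝ} (hm : IsPointMeasure m) (a b : ℝ) :
    m (Set.Ico a b) < ∞ := by
  obtain ⟨n, hn⟩ := hm (Set.Ico a b) measurableSet_Ico (Set.Icc a b) isCompact_Icc
    Set.Ico_subset_Icc_self
  simp [hn]

/-- If the points of `m` are enumerated by `X`, only finitely many of them lie in a set of finite
measure. -/
theorem IsPointMeasure.eventually_notMem {m : Measure ℝ} (hm : IsPointMeasure m) {X : ℕ → ℝ}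
    (hX : Function.Injective X) (hr : Set.range X = points m) {B : Set ℝ} (hB : m B ≠ ∞) :
    ∀ᶠ n in Filter.atTop, X n ∉ B := by
  have h1 := measure_eq_tsum_of_enumeration hX (by rw [hr]; exact hm.measure_compl_points) B
  have h2 := ENNReal.tendsto_atTop_zero_of_tsum_ne_top (h1 ▸ hB)
  filter_upwards [h2.eventually (gt_mem_nhds (zero_lt_one))] with n hn hnB
  rw [Set.indicator_of_mem hnB] at hn
  obtain ⟨k, hk⟩ := hm {X n} (measurableSet_singleton _) {X n} isCompact_singleton subset_rfl
  have hpos : 0 < m {X n} := by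
    have : X n ∈ points m := hr ▸ ⟨n, rfl⟩
    exact this
  rw [hk] at hn hpos
  have h3 : k < 1 := by exact_mod_cast hn
  have h4 : 0 < k := by exact_mod_cast hpos
  omega

theorem measure_eq_sum_of_notMem {m : Measure ℝ} {X : ℕ → ℝ} (hX : Function.Injective X)
    (hm : m (Set.range X)ᶜ = 0) {B : Set ℝ} {k : ℕ} (hk : ∀ n ≥ k, X n ∉ B) :
    m B = ∑ n ∈ Finset.range k, B.indicator (fun x => m {x}) (X n) := by
  rw [measure_eq_tsum_of_enumeration hX hm B]
  refine tsum_eq_sum fun n hn => ?_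
  exact Set.indicator_of_notMem (hk n (by simpa using hn)) _

theorem IsPointMeasure.measure_eq_zero_iff {m : Measure ℝ} (hm : IsPointMeasure m) {B : Set ℝ} :
    m B = 0 ↔ ∀ x ∈ points m, x ∉ B := by
  constructor
  · intro h x hx hxB
    exact (ne_of_gt hx) (measure_mono_null (Set.singleton_subset_iff.2 hxB) h)
  · intro h
    exact measure_mono_null (fun x hx (hx' : x ∈ points m) => h x hx' hx) hm.measure_compl_points

/-! ### Edges as sorted pairs of real numbers. -/

theorem measurable_sym2_mk : Measurable (fun p : ℝ × ℝ => s(p.1, p.2)) := fun _ h => h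

theorem measurable_sym2_iff {β : Type*} [MeasurableSpace β] {f : Sym2 ℝ → β} :
    Measurable f ↔ Measurable (fun p : ℝ × ℝ => f s(p.1, p.2)) :=
  ⟨fun h => h.comp measurable_sym2_mk, fun h _ hs => h hs⟩

theorem continuous_sym2_mk : Continuous (fun p : ℝ × ℝ => s(p.1, p.2)) := continuous_quot_mk

@[fun_prop]
theorem measurable_sym2_inf : Measurable (Sym2.inf : Sym2 ℝ → ℝ) :=
  measurable_sym2_iff.2 (by simp only [Sym2.inf_mk]; fun_prop)

@[fun_prop]
theorem measurable_sym2_sup : Measurable (Sym2.sup : Sym2 ℝ → ℝ) :=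
  measurable_sym2_iff.2 (by simp only [Sym2.sup_mk]; fun_prop)

@[fun_prop]
theorem measurable_sym2_shift (t : ℝ) : Measurable (Sym2.map (fun x : ℝ => x + t)) := by
  refine measurable_sym2_iff.2 ?_
  simp only [Sym2.map_mk]
  exact measurable_sym2_mk.comp (f := fun p : ℝ × ℝ => (p.1 + t, p.2 + t)) (by fun_prop)

theorem sym2_inf_shift (t : ℝ) (e : Sym2 ℝ) : (e.map (fun x => x + t)).inf = e.inf + t := by
  induction e with | _ x y => simp [min_add_add_right]

theorem sym2_sup_shift (t : ℝ) (e : Sym2 ℝ) : (e.map (fun x => x + t)).sup = e.sup + t := by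
  induction e with | _ x y => simp [max_add_add_right]

theorem sym2_inf_le_sup (e : Sym2 ℝ) : e.inf ≤ e.sup := by
  induction e with | _ x y => simp

theorem sym2_mk_inf_sup (e : Sym2 ℝ) : s(e.inf, e.sup) = e := by
  induction e with | _ x y =>
    rcases le_total x y with h | h
    · simp [h]
    · simp [h, Sym2.eq_swap]

theorem sym2_mem_iff (x : ℝ) (e : Sym2 ℝ) : x ∈ e ↔ e.inf = x ∨ e.sup = x := by
  conv_lhs => rw [← sym2_mk_inf_sup e]
  rw [Sym2.mem_iff, eq_comm, @eq_comm _ x]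

theorem sym2_inf_mem (e : Sym2 ℝ) : e.inf ∈ e := (sym2_mem_iff _ _).2 (Or.inl rfl)

theorem sym2_sup_mem (e : Sym2 ℝ) : e.sup ∈ e := (sym2_mem_iff _ _).2 (Or.inr rfl)

/-- The pair of end points of an edge, in increasing order. -/
def sortedPair (e : Sym2 ℝ) : ℝ × ℝ := (e.inf, e.sup)

@[fun_prop]
theorem measurable_sortedPair : Measurable sortedPair := by
  unfold sortedPair; fun_prop

theorem sortedPair_preimage_singleton (e : Sym2 ℝ) : sortedPair ⁻¹' {sortedPair e} = {e} := by
  ext e'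
  simp only [Set.mem_preimage, Set.mem_singleton_iff]
  refine ⟨fun h => ?_, fun h => by rw [h]⟩
  simp only [sortedPair, Prod.mk.injEq] at h
  rw [← sym2_mk_inf_sup e', h.1, h.2, sym2_mk_inf_sup]

theorem exists_of_mem_points_map_sortedPair {m : Measure (Sym2 ℝ)} {p : ℝ × ℝ}
    (hp : p ∈ points (m.map sortedPair)) : ∃ e ∈ points m, sortedPair e = p := by
  have h : 0 < m (sortedPair ⁻¹' {p}) := by
    rw [← Measure.map_apply measurable_sortedPair (measurableSet_singleton _)]
    exact hp
  obtain ⟨e, he⟩ := nonempty_of_measure_ne_zero h.ne'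
  have he : sortedPair e = p := he
  refine ⟨e, ?_, he⟩
  rw [← he, sortedPair_preimage_singleton] at h
  exact h

/-- This carries edges over to `ℝ × ℝ`, where the results above on atoms and integrality apply. The
quotient map sends a compact set of pairs to a compact set of edges containing its preimage under
`sortedPair`. -/
theorem IsPointMeasure.map_sortedPair {m : Measure (Sym2 ℝ)} (hm : IsPointMeasure m) :
    IsPointMeasure (m.map sortedPair) := by
  intro A hA K hK hAK
  rw [Measure.map_apply measurable_sortedPair hA]
  refine hm _ (measurable_sortedPair hA) _ (hK.image continuous_sym2_mk) ?_
  intro e he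
  exact ⟨sortedPair e, hAK he, sym2_mk_inf_sup e⟩

/-! ### Degrees, cuts and the parity balance. -/

/-- The degree measure of a set of edges: the mass of `A` is the number of edge ends in `A`. -/
noncomputable def degreeMeasure (m : Measure (Sym2 ℝ)) : Measure ℝ :=
  m.map Sym2.inf + m.map Sym2.sup

/-- The number of edges which cross `z`, including those with right end point `z`. -/
noncomputable def cut (m : Measure (Sym2 ℝ)) (z : ℝ) : ℝ≥0∞ :=
  m (Sym2.inf ⁻¹' Set.Iio z ∩ Sym2.sup ⁻¹' Set.Ici z)

theorem measurableSet_cut (z : ℝ) : 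
    MeasurableSet (Sym2.inf ⁻¹' Set.Iio z ∩ Sym2.sup ⁻¹' Set.Ici z : Set (Sym2 ℝ)) :=
  (measurable_sym2_inf measurableSet_Iio).inter (measurable_sym2_sup measurableSet_Ici)

theorem degreeMeasure_apply (m : Measure (Sym2 ℝ)) {A : Set ℝ} (hA : MeasurableSet A) :
    degreeMeasure m A = m (Sym2.inf ⁻¹' A) + m (Sym2.sup ⁻¹' A) := by
  rw [degreeMeasure, Measure.add_apply, Measure.map_apply measurable_sym2_inf hA,
    Measure.map_apply measurable_sym2_sup hA]

theorem measurable_degreeMeasure_apply {A : Set ℝ} (hA : MeasurableSet A) :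
    Measurable (fun m : Measure (Sym2 ℝ) => degreeMeasure m A) := by
  simp_rw [degreeMeasure_apply _ hA]
  exact (Measure.measurable_coe (measurable_sym2_inf hA)).add
    (Measure.measurable_coe (measurable_sym2_sup hA))

theorem measurable_cut (z : ℝ) : Measurable (fun m : Measure (Sym2 ℝ) => cut m z) :=
  Measure.measurable_coe (measurableSet_cut z)

theorem degreeMeasure_shift (m : Measure (Sym2 ℝ)) (t : ℝ) {A : Set ℝ} (hA : MeasurableSet A) :
    degreeMeasure (m.map (Sym2.map (fun x => x + t))) A =
      degreeMeasure m ((fun x => x + t) ⁻¹' A) := by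
  rw [degreeMeasure_apply _ hA, degreeMeasure_apply _ (measurable_add_const t hA),
    Measure.map_apply (measurable_sym2_shift t) (measurable_sym2_inf hA),
    Measure.map_apply (measurable_sym2_shift t) (measurable_sym2_sup hA)]
  simp only [← Set.preimage_comp, Function.comp_def, sym2_inf_shift, sym2_sup_shift]

theorem cut_shift (m : Measure (Sym2 ℝ)) (t z : ℝ) :
    cut (m.map (Sym2.map (fun x => x + t))) z = cut m (z - t) := by
  rw [cut, cut, Measure.map_apply (measurable_sym2_shift t) (measurableSet_cut z)]
  congr 1
  ext e
  simp [sym2_inf_shift, sym2_sup_shift, lt_sub_iff_add_lt]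

/-- Each edge contributes equally to both sides of `key`: it joins the cut when its left end is
passed and leaves when its right end is passed. Written without subtraction, the identity also holds
for infinite cuts. -/
theorem cut_add_degreeMeasure (m : Measure (Sym2 ℝ)) {a b : ℝ} (hab : a ≤ b) :
    cut m b + degreeMeasure m (Set.Ico a b) = cut m a + 2 * m (Sym2.inf ⁻¹' Set.Ico a b) := by
  have hi : MeasurableSet (Sym2.inf ⁻¹' Set.Ico a b) := measurable_sym2_inf measurableSet_Ico
  have hs : MeasurableSet (Sym2.sup ⁻¹' Set.Ico a b) := measurable_sym2_sup measurableSet_Ico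
  have key : cut m b + m (Sym2.sup ⁻¹' Set.Ico a b) = cut m a + m (Sym2.inf ⁻¹' Set.Ico a b) := by
    unfold cut
    rw [← lintegral_indicator_one hi, ← lintegral_indicator_one hs,
      ← lintegral_indicator_one (measurableSet_cut a),
      ← lintegral_indicator_one (measurableSet_cut b),
      ← lintegral_add_left (measurable_one.indicator (measurableSet_cut b)),
      ← lintegral_add_left (measurable_one.indicator (measurableSet_cut a))]
    congr with e
    have := sym2_inf_le_sup e
    classical
    simp only [Set.indicator_apply, Set.mem_inter_iff, Set.mem_preimage, Set.mem_Iio, Set.mem_Ici,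
      Set.mem_Ico, Pi.one_apply, ← not_lt (b := a), ← not_lt (b := b)]
    by_cases h1 : e.inf < a <;> by_cases h2 : e.inf < b <;> by_cases h3 : e.sup < a <;>
      by_cases h4 : e.sup < b <;> first | (exfalso; linarith) | simp [h1, h2, h3, h4]
  rw [degreeMeasure_apply _ measurableSet_Ico, two_mul, add_comm (m (Sym2.inf ⁻¹' _)), ← add_assoc,
    key, add_assoc]

/-- The parity character `(-1) ^ n`, extended by `0` at infinity. -/
noncomputable def parity (x : ℝ≥0∞) : ℝ := if x = ∞ then 0 else Real.cos (Real.pi * x.toReal)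

@[fun_prop]
theorem measurable_parity : Measurable parity :=
  Measurable.ite (measurableSet_singleton _) measurable_const (by fun_prop)

theorem abs_parity_le (x : ℝ≥0∞) : |parity x| ≤ 1 := by
  unfold parity
  split_ifs
  · simp
  · exact Real.abs_cos_le_one _

@[simp]
theorem parity_natCast (n : ℕ) : parity n = (-1) ^ n := by
  rw [parity, if_neg (ENNReal.natCast_ne_top n), ENNReal.toReal_natCast, mul_comm,
    Real.cos_nat_mul_pi]

@[simp]
theorem parity_top : parity ∞ = 0 := by simp [parity]

theorem parity_add {x y : ℝ≥0∞} (hx : ∃ n : ℕ, x = n) (hy : ∃ n : ℕ, y = n) :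
    parity (x + y) = parity x * parity y := by
  obtain ⟨a, rfl⟩ := hx
  obtain ⟨b, rfl⟩ := hy
  rw [← Nat.cast_add, parity_natCast, parity_natCast, parity_natCast, pow_add]

/-- This is `cut_add_degreeMeasure` modulo 2. If `cut m a` is infinite its parity is `0`; otherwise
finiteness of the degree on `[a, b)` makes `cut m b` finite too. -/
theorem parity_cut_mul {m : Measure (Sym2 ℝ)} (hm : IsPointMeasure m) {a b : ℝ} (hab : a ≤ b)
    (hfin : degreeMeasure m (Set.Ico a b) ≠ ∞) :
    parity (cut m a) * parity (cut m b) * parity (degreeMeasure m (Set.Ico a b)) =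
      if cut m a = ∞ then 0 else 1 := by
  have hnat : ∀ S : Set (ℝ × ℝ), MeasurableSet S → m (sortedPair ⁻¹' S) ≠ ∞ →
      ∃ n : ℕ, m (sortedPair ⁻¹' S) = n := by
    intro S hS h
    rw [← Measure.map_apply measurable_sortedPair hS] at h ⊢
    exact hm.map_sortedPair.exists_nat hS h
  have hcut : ∀ z, cut m z ≠ ∞ → ∃ n : ℕ, cut m z = n := fun z hz =>
    hnat (Prod.fst ⁻¹' Set.Iio z ∩ Prod.snd ⁻¹' Set.Ici z)
      ((measurable_fst measurableSet_Iio).inter (measurable_snd measurableSet_Ici)) hz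
  have hd := degreeMeasure_apply m (measurableSet_Ico (a := a) (b := b))
  rw [hd] at hfin
  obtain ⟨hi', hs'⟩ := ENNReal.add_ne_top.1 hfin
  obtain ⟨i, hi⟩ := hnat (Prod.fst ⁻¹' Set.Ico a b) (measurable_fst measurableSet_Ico) hi'
  obtain ⟨s, hs⟩ := hnat (Prod.snd ⁻¹' Set.Ico a b) (measurable_snd measurableSet_Ico) hs'
  have hi : m (Sym2.inf ⁻¹' Set.Ico a b) = i := hi
  have hs : m (Sym2.sup ⁻¹' Set.Ico a b) = s := hs
  have key := cut_add_degreeMeasure m hab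
  rw [hd, hi, hs] at key
  rw [hd, hi, hs]
  split_ifs with h
  · simp [h]
  · obtain ⟨p, hp⟩ := hcut a h
    have hb : cut m b ≠ ∞ := by
      intro hb
      rw [hb, hp] at key
      have : (p : ℝ≥0∞) + 2 * i ≠ ∞ := by
        exact_mod_cast ENNReal.natCast_ne_top (p + 2 * i)
      exact this (by rw [← key]; simp)
    obtain ⟨q, hq⟩ := hcut b hb
    rw [hp, hq] at key
    rw [hp, hq]
    have key' : q + (i + s) = p + 2 * i := by exact_mod_cast key
    have : ((i : ℝ≥0∞) + s) = ((i + s : ℕ) : ℝ≥0∞) := by push_cast; rfl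
    rw [this, parity_natCast, parity_natCast, parity_natCast, mul_assoc, ← pow_add, key', ← pow_add]
    rw [← add_assoc, ← two_mul, ← mul_add, pow_mul]
    simp

/-- Besides the strictly crossing edges, `cut m z` counts only edges with right end `z`, which the
degree at `z` controls. A finite set of edges has finite mass whatever the multiplicities. -/
theorem cut_lt_top_of_finite {m : Measure (Sym2 ℝ)} (hm : IsPointMeasure m) {z : ℝ}
    (hdeg : degreeMeasure m {z} ≠ ∞) (h : {e | e ∈ points m ∧ Crosses e z}.Finite) :
    cut m z < ∞ := by
  have hm' := hm.map_sortedPair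
  have := hm'.isFiniteMeasureOnCompacts
  set S : Set (ℝ × ℝ) := Prod.fst ⁻¹' Set.Iio z ∩ Prod.snd ⁻¹' Set.Ioi z
  have hS : MeasurableSet S := (measurable_fst measurableSet_Iio).inter
    (measurable_snd measurableSet_Ioi)
  have h1 : m (sortedPair ⁻¹' S) < ∞ := by
    rw [← Measure.map_apply measurable_sortedPair hS,
      ← measure_inter_conull hm'.measure_compl_points]
    have hfin : (S ∩ points (m.map sortedPair)).Finite := by
      refine (h.image sortedPair).subset ?_
      rintro p ⟨hpS, hp⟩
      obtain ⟨e, he, rfl⟩ := exists_of_mem_points_map_sortedPair hp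
      exact ⟨e, ⟨he, e.inf, e.sup, (sym2_mk_inf_sup e).symm, hpS⟩, rfl⟩
    exact hfin.isCompact.measure_lt_top
  have h2 : m (Sym2.sup ⁻¹' {z}) < ∞ := by
    rw [degreeMeasure_apply m (measurableSet_singleton z)] at hdeg
    exact (ENNReal.add_ne_top.1 hdeg).2.lt_top
  refine (measure_mono ?_).trans_lt ((measure_union_le (sortedPair ⁻¹' S) _).trans_lt
    (ENNReal.add_lt_top.2 ⟨h1, h2⟩))
  rintro e ⟨he1, he2⟩
  rcases (Set.mem_Ici.1 (Set.mem_preimage.1 he2)).lt_or_eq with h | h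
  · exact Or.inl ⟨he1, h⟩
  · exact Or.inr h.symm

/-- The marks are determined by the edges. -/
theorem degreeMeasure_eq {m : Measure (Sym2 ℝ)} (hm : IsPointMeasure m) {ν ρ : Measure ℝ}
    (hρ : IsPointMeasure ρ) (hpts : points ρ = points ν)
    (hend : ∀ e ∈ points m, ∀ x ∈ e, x ∈ points ν)
    (hdeg : ∀ x ∈ points ν, m {e | x ∈ e} + m {s(x, x)} = ρ {x}) : degreeMeasure m = ρ := by
  have hm' := hm.map_sortedPair
  have hc := hρ.countable_points
  refine measure_eq_of_singleton_eq hc ?_ hρ.measure_compl_points fun x hx => ?_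
  · rw [degreeMeasure_apply m hc.measurableSet.compl]
    have key : ∀ S : Set (ℝ × ℝ), MeasurableSet S → (∀ e ∈ points m, sortedPair e ∉ S) →
        m (sortedPair ⁻¹' S) = 0 := by
      intro S hS h
      rw [← Measure.map_apply measurable_sortedPair hS]
      refine measure_mono_null (fun p hp => ?_) hm'.measure_compl_points
      intro hp'
      obtain ⟨e, he, rfl⟩ := exists_of_mem_points_map_sortedPair hp'
      exact h e he hp
    have h1 := key (Prod.fst ⁻¹' (points ρ)ᶜ) (measurable_fst hc.measurableSet.compl)
      (fun e he hS => hS (by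
        rw [hpts]; exact hend e he _ (sym2_inf_mem e)))
    have h2 := key (Prod.snd ⁻¹' (points ρ)ᶜ) (measurable_snd hc.measurableSet.compl)
      (fun e he hS => hS (by
        rw [hpts]; exact hend e he _ (sym2_sup_mem e)))
    exact add_eq_zero.2 ⟨h1, h2⟩
  · rw [hpts] at hx
    rw [← hdeg x hx, degreeMeasure_apply m (measurableSet_singleton x)]
    have hu : {e : Sym2 ℝ | x ∈ e} = Sym2.inf ⁻¹' {x} ∪ Sym2.sup ⁻¹' {x} := by
      ext e
      simp [sym2_mem_iff]
    have hint : {s(x, x)} = (Sym2.inf ⁻¹' {x} ∩ Sym2.sup ⁻¹' {x} : Set (Sym2 ℝ)) := by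
      rw [← sortedPair_preimage_singleton s(x, x)]
      ext e
      simp [sortedPair]
    rw [hu, hint, measure_union_add_inter _ (measurable_sym2_sup (measurableSet_singleton x))]

/-! ### Poisson counts on dyadic cells. -/

/-- `1 - exp (-l) * (1 + l) ≤ 1 - (1 - l) * (1 + l) = l ^ 2`. The quadratic order is what makes the
union bound over fine cells tend to zero. -/
theorem poissonMeasure_one_lt_le (l : ℝ≥0) :
    poissonMeasure l {n | 1 < n} ≤ ENNReal.ofReal ((l : ℝ) ^ 2) := by
  have h : {n : ℕ | 1 < n} = ({0, 1} : Set ℕ)ᶜ := by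
    ext n; simp; omega
  have h01 : (poissonMeasure l).real {0, 1} = Real.exp (-l) + Real.exp (-l) * l := by
    rw [Set.insert_eq, measureReal_union (by simp) (measurableSet_singleton _),
      poissonMeasure_real_singleton, poissonMeasure_real_singleton]
    simp
  rw [h, ← ofReal_measureReal, probReal_compl_eq_one_sub (by measurability), h01]
  refine ENNReal.ofReal_le_ofReal ?_
  have h1 : 1 - (l : ℝ) ≤ Real.exp (-l) := by
    have := Real.add_one_le_exp (-(l : ℝ)); linarith
  nlinarith [l.coe_nonneg]

theorem integral_pow_poissonMeasure (l : ℝ≥0) (c : ℂ) :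
    ∫ n, c ^ n ∂(poissonMeasure l) = Complex.exp (l * (c - 1)) := by
  rw [integral_poissonMeasure]
  have h := (NormedSpace.expSeries_div_hasSum_exp ((l : ℂ) * c)).mul_left (Complex.exp (-l))
  rw [← Complex.exp_eq_exp_ℂ, ← Complex.exp_add] at h
  convert h.tsum_eq using 1
  · congr with n
    rw [Complex.real_smul]
    push_cast
    rw [mul_pow]
    ring
  · congr 1; ring

/-- The natural number closest from below to an extended non-negative real number. -/
noncomputable def count (x : ℝ≥0∞) : ℕ := ⌊x.toReal⌋₊

@[fun_prop]
theorem measurable_count : Measurable count := Nat.measurable_floor.comp ENNReal.measurable_toReal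

@[simp]
theorem count_natCast (n : ℕ) : count n = n := by simp [count]

section Poisson

variable {Ω : Type*} [MeasurableSpace Ω] {P : Measure Ω} {r : ℝ≥0} {N ξ : Ω → Measure ℝ}

theorem IsPoissonProcess.measure_one_lt_le (hN : IsPoissonProcess r N P) {A : Set ℝ}
    (hA : MeasurableSet A) (h : volume A ≠ ∞) :
    P {ω | 1 < N ω A} ≤ ENNReal.ofReal ((r * (volume A).toReal) ^ 2) := by
  have hm : MeasurableSet {x : ℝ≥0∞ | 1 < x} := measurableSet_Ioi
  rw [(hN.hasLaw A hA h).measure_eq hm, Measure.map_apply (by fun_prop) hm]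
  convert poissonMeasure_one_lt_le _ using 2
  · ext n
    simp
  · simp [← ENNReal.coe_toNNReal_eq_toReal]

theorem IsPoissonProcess.integral_pow_count (hN : IsPoissonProcess r N P) {A : Set ℝ}
    (hA : MeasurableSet A) (h : volume A ≠ ∞) (c : ℂ) :
    ∫ ω, c ^ count (N ω A) ∂P = Complex.exp (r * (volume A).toReal * (c - 1)) := by
  have hm : Measurable fun x : ℝ≥0∞ => c ^ count x :=
    (measurable_from_nat (f := fun n => c ^ n)).comp measurable_count
  have := (hN.hasLaw A hA h).integral_comp (f := fun x : ℝ≥0∞ => c ^ count x)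
    hm.aestronglyMeasurable
  rw [Function.comp_def] at this
  rw [this, integral_map (by fun_prop) hm.aestronglyMeasurable]
  simp only [count_natCast, integral_pow_poissonMeasure]
  simp [← ENNReal.coe_toNNReal_eq_toReal]

theorem IsPoissonProcess.ae_ne_top (hN : IsPoissonProcess r N P) {A : Set ℝ}
    (hA : MeasurableSet A) (h : volume A ≠ ∞) : ∀ᵐ ω ∂P, N ω A ≠ ∞ := by
  have hp : Measurable fun x : ℝ≥0∞ => x ≠ ∞ := by
    exact measurableSet_setOfPred.1 (measurableSet_singleton (∞ : ℝ≥0∞)).compl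
  rw [(hN.hasLaw A hA h).ae_iff hp, ae_map_iff (by fun_prop) (measurableSet_setOfPred.2 hp)]
  simp

/-- The dyadic interval `[j / 2 ^ n, (j + 1) / 2 ^ n)`. -/
def cell (n : ℕ) (j : ℤ) : Set ℝ := Set.Ico ((j : ℝ) / 2 ^ n) (((j + 1 : ℤ) : ℝ) / 2 ^ n)

@[measurability]
theorem measurableSet_cell (n : ℕ) (j : ℤ) : MeasurableSet (cell n j) := measurableSet_Ico

theorem mem_cell_iff {n : ℕ} {j : ℤ} {x : ℝ} : x ∈ cell n j ↔ ⌊x * 2 ^ n⌋ = j := by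
  have h : (0 : ℝ) < 2 ^ n := by positivity
  rw [cell, Set.mem_Ico, Int.floor_eq_iff, div_le_iff₀ h, lt_div_iff₀ h]
  push_cast
  rfl

theorem disjoint_cell (n : ℕ) {i j : ℤ} (h : i ≠ j) : Disjoint (cell n i) (cell n j) :=
  Set.disjoint_left.2 fun _ hi hj => h ((mem_cell_iff.1 hi).symm.trans (mem_cell_iff.1 hj))

theorem volume_cell (n : ℕ) (j : ℤ) : volume (cell n j) = ENNReal.ofReal ((2 ^ n)⁻¹) := by
  rw [cell, Real.volume_Ico]
  congr 1
  push_cast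
  ring

/-- The indices of the dyadic intervals of order `n` contained in `[-n, n)`. -/
noncomputable def window (n : ℕ) : Finset ℤ := Finset.Ico (-(n * 2 ^ n) : ℤ) (n * 2 ^ n)

/-- The event that two points fall into a common dyadic interval of order `n` in `[-n, n)`. -/
def crowded (N : Ω → Measure ℝ) (n : ℕ) : Set Ω := ⋃ j ∈ window n, {ω | 1 < N ω (cell n j)}

/-- Union bound: `2 * n * 2 ^ n` cells, each crowded with probability at most `(r / 2 ^ n) ^ 2`. -/
theorem IsPoissonProcess.tendsto_measure_crowded (hN : IsPoissonProcess r N P) :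
    Filter.Tendsto (fun n => P (crowded N n)) Filter.atTop (nhds 0) := by
  have hle : ∀ n, P (crowded N n) ≤ ENNReal.ofReal (2 * (r : ℝ) ^ 2 * (n * (2⁻¹ : ℝ) ^ n)) := by
    intro n
    refine (measure_biUnion_finset_le _ _).trans ?_
    refine (Finset.sum_le_sum fun j _ => hN.measure_one_lt_le (measurableSet_cell n j)
      (by simp [volume_cell])).trans ?_
    simp_rw [volume_cell]
    rw [Finset.sum_const, nsmul_eq_mul, ← ENNReal.ofReal_natCast,
      ← ENNReal.ofReal_mul (by positivity)]
    refine ENNReal.ofReal_le_ofReal (le_of_eq ?_)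
    have hc : (((window n).card : ℕ) : ℝ) = 2 * n * 2 ^ n := by
      have : (window n).card = 2 * n * 2 ^ n := by
        rw [window, Int.card_Ico]
        zify
        rw [Int.toNat_of_nonneg (by have : (0 : ℤ) ≤ n * 2 ^ n := by positivity
                                    linarith)]
        ring
      rw [this]; push_cast; ring
    rw [hc, ENNReal.toReal_ofReal (by positivity), inv_pow]
    field_simp
  have hlim : Filter.Tendsto (fun n : ℕ => ENNReal.ofReal (2 * (r : ℝ) ^ 2 * (n * (2⁻¹ : ℝ) ^ n)))
      Filter.atTop (nhds 0) := by
    have h := tendsto_self_mul_const_pow_of_lt_one (r := (2⁻¹ : ℝ)) (by norm_num) (by norm_num)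
    have := ENNReal.tendsto_ofReal (h.const_mul (2 * (r : ℝ) ^ 2))
    simpa using this
  exact tendsto_of_tendsto_of_tendsto_of_le_of_le tendsto_const_nhds hlim (fun _ => zero_le)
    hle

theorem floor_mem_window {n : ℕ} {x : ℝ} (hx : |x| < n) : ⌊x * 2 ^ n⌋ ∈ window n := by
  have h : (0 : ℝ) < 2 ^ n := by positivity
  obtain ⟨h1, h2⟩ := abs_lt.1 hx
  rw [window, Finset.mem_Ico, Int.le_floor, Int.floor_lt]
  push_cast
  constructor <;> nlinarith

/-- A multiple point in `(-m, m)` crowds its cell at every order `n ≥ m`. -/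
theorem IsPoissonProcess.ae_simple (hN : IsPoissonProcess r N P) :
    ∀ᵐ ω ∂P, ∀ x, N ω {x} ≤ 1 := by
  have key : ∀ m : ℕ, ∀ᵐ ω ∂P, ∀ x : ℝ, |x| < m → N ω {x} ≤ 1 := by
    intro m
    rw [ae_iff]
    refine le_antisymm (ge_of_tendsto hN.tendsto_measure_crowded ?_) zero_le
    filter_upwards [Filter.eventually_ge_atTop m] with n hn
    refine measure_mono fun ω hω => ?_
    simp only [Set.mem_ofPred_eq, not_forall, not_le] at hω
    obtain ⟨x, hx, h1⟩ := hω
    have hx' : |x| < n := hx.trans_le (by exact_mod_cast hn)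
    simp only [crowded, Set.mem_iUnion]
    refine ⟨_, floor_mem_window hx', ?_⟩
    exact h1.trans_le (measure_mono (Set.singleton_subset_iff.2 (mem_cell_iff.2 rfl)))
  filter_upwards [ae_all_iff.2 key] with ω hω x
  obtain ⟨m, hm⟩ := exists_nat_gt |x|
  exact hω m x hm

end Poisson

/-! ### Characteristic functions of the marks. -/

/-- The characteristic function of a distribution on the natural numbers. -/
noncomputable def markCharFun (μ : Measure ℕ) (θ : ℝ) : ℂ :=
  ∫ k, Complex.exp ((θ * k : ℝ) * Complex.I) ∂μ

theorem measurable_markCharFun (μ : Measure ℕ) [IsProbabilityMeasure μ] : Measurable (markCharFun μ) := by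
  have : StronglyMeasurable fun p : ℝ × ℕ => Complex.exp ((p.1 * p.2 : ℝ) * Complex.I) := by
    apply Measurable.stronglyMeasurable
    fun_prop
  exact this.integral_prod_right.measurable

@[simp]
theorem markCharFun_zero (μ : Measure ℕ) [IsProbabilityMeasure μ] : markCharFun μ 0 = 1 := by
  simp [markCharFun]

theorem norm_markCharFun_le (μ : Measure ℕ) [IsProbabilityMeasure μ] (θ : ℝ) :
    ‖markCharFun μ θ‖ ≤ 1 := by
  refine (norm_integral_le_of_norm_le_const (C := 1) (Filter.Eventually.of_forall fun k => ?_)).trans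
    (by simp)
  rw [Complex.norm_exp_ofReal_mul_I]

section Marks

variable {Ω : Type*} [MeasurableSpace Ω] {P : Measure Ω} [IsProbabilityMeasure P] {N : Ω → Measure ℝ}

/-- Fubini: with the positions frozen, the marks are still i.i.d. with law `μ`, so each factor
integrates to its characteristic function. -/
theorem integral_prod_marks {μ : Measure ℕ} [IsProbabilityMeasure μ] (hN : Measurable N)
    {X : ℕ → Measure ℝ → ℝ} {D : ℕ → Ω → ℕ} (hX : ∀ n, Measurable (X n)) (hD : ∀ n, Measurable (D n))
    (hlaw : ∀ n, HasLaw (D n) μ P) (hind : iIndepFun D P) (hND : IndepFun N (fun ω n => D n ω) P)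
    {τ : ℝ → ℝ} (hτ : Measurable τ) (m : ℕ) :
    ∫ ω, ∏ n ∈ Finset.range m,
        Complex.exp ((τ (X n (N ω)) * D n ω : ℝ) * Complex.I) ∂P =
      ∫ ω, ∏ n ∈ Finset.range m, markCharFun μ (τ (X n (N ω))) ∂P := by
  have hD' : Measurable fun ω n => D n ω := measurable_pi_lambda _ hD
  set g : Measure ℝ × (ℕ → ℕ) → ℂ := fun p => ∏ n ∈ Finset.range m,
    Complex.exp ((τ (X n p.1) * p.2 n : ℝ) * Complex.I) with hg
  have hgm : Measurable g := by
    refine Finset.measurable_prod _ fun n _ => ?_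
    have h1 : Measurable fun p : Measure ℝ × (ℕ → ℕ) => τ (X n p.1) :=
      hτ.comp ((hX n).comp measurable_fst)
    have h2 : Measurable fun p : Measure ℝ × (ℕ → ℕ) => ((p.2 n : ℕ) : ℝ) :=
      (measurable_from_nat (f := fun k : ℕ => (k : ℝ))).comp
        ((measurable_pi_apply n).comp measurable_snd)
    exact Complex.measurable_exp.comp ((Complex.measurable_ofReal.comp (h1.mul h2)).mul_const _)
  have hgn : ∀ p, ‖g p‖ ≤ 1 := by
    intro p
    rw [hg]
    simp only [norm_prod, Complex.norm_exp_ofReal_mul_I, Finset.prod_const_one, le_refl]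
  have hprod := (indepFun_iff_map_prod_eq_prod_map_map hN.aemeasurable hD'.aemeasurable).1 hND
  have := Measure.isProbabilityMeasure_map (μ := P) hN.aemeasurable
  have := Measure.isProbabilityMeasure_map (μ := P) hD'.aemeasurable
  have hphi : Measurable fun ν : Measure ℝ => ∏ n ∈ Finset.range m, markCharFun μ (τ (X n ν)) :=
    Finset.measurable_prod _ fun n _ => (measurable_markCharFun μ).comp (hτ.comp (hX n))
  calc _ = ∫ ω, g (N ω, fun n => D n ω) ∂P := rfl
    _ = ∫ p, g p ∂((P.map N).prod (P.map fun ω n => D n ω)) := by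
        rw [← hprod, integral_map (hN.prodMk hD').aemeasurable hgm.aestronglyMeasurable]
    _ = ∫ ν, ∫ d, g (ν, d) ∂(P.map fun ω n => D n ω) ∂(P.map N) :=
        integral_prod _ (Integrable.of_bound hgm.aestronglyMeasurable 1
          (Filter.Eventually.of_forall hgn))
    _ = ∫ ν, ∏ n ∈ Finset.range m, markCharFun μ (τ (X n ν)) ∂(P.map N) := by
        congr with ν
        have hgν : Measurable fun d => g (ν, d) := hgm.comp measurable_prodMk_left
        rw [integral_map hD'.aemeasurable hgν.aestronglyMeasurable]
        simp only [hg]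
        simp_rw [Finset.prod_range]
        have hind' : iIndepFun (fun i : Fin m => D i) P := hind.precomp Fin.val_injective
        have h := iIndepFun.integral_fun_prod_comp (X := fun i : Fin m => D i)
          (f := fun (i : Fin m) (k : ℕ) => Complex.exp ((τ (X i ν) * (k : ℕ) : ℝ) * Complex.I)) hind'
          (fun i => (hD i).aemeasurable) (fun i => measurable_from_nat.aestronglyMeasurable)
        rw [h]
        refine Finset.prod_congr rfl fun i _ => ?_
        have h' := (hlaw i).integral_comp
          (f := fun k : ℕ => Complex.exp ((τ (X i ν) * (k : ℕ) : ℝ) * Complex.I))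
          measurable_from_nat.aestronglyMeasurable
        exact h'
    _ = _ := integral_map hN.aemeasurable hphi.aestronglyMeasurable

end Marks

/-! ### Joint law of the total marks of disjoint sets. -/

section JointCharFun

variable {ι : Type*} [Fintype ι]

theorem sum_indicator_mul_eq {B : ι → Set ℝ} (θ : ι → ℝ) {ρ : Measure ℝ} {x : ℕ → ℝ} {d : ℕ → ℕ}
    {m : ℕ} (hd : ∀ n, ρ {x n} = d n) (hx : Function.Injective x) (hρ : ρ (Set.range x)ᶜ = 0)
    (hm : ∀ i, ∀ n ≥ m, x n ∉ B i) :
    ∑ n ∈ Finset.range m, (∑ i, (B i).indicator (fun _ => θ i) (x n)) * d n =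
      ∑ i, θ i * (ρ (B i)).toReal := by
  classical
  have h : ∀ i, (ρ (B i)).toReal = ∑ n ∈ Finset.range m, (B i).indicator (fun _ => (d n : ℝ)) (x n) := by
    intro i
    rw [measure_eq_sum_of_notMem hx hρ (hm i), ENNReal.toReal_sum]
    · refine Finset.sum_congr rfl fun n _ => ?_
      by_cases h : x n ∈ B i <;> simp [h, hd]
    · intro n _
      by_cases h : x n ∈ B i <;> simp [h, hd]
  simp_rw [h, Finset.mul_sum, Finset.sum_mul]
  rw [Finset.sum_comm]
  refine Finset.sum_congr rfl fun i _ => Finset.sum_congr rfl fun n _ => ?_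
  by_cases h : x n ∈ B i <;> simp [h]

/-- By disjointness a point lies in at most one `B i`, so its factor is a single `markCharFun μ (θ
i)`, or `1` outside all of them. -/
theorem prod_markCharFun_eq {μ : Measure ℕ} [IsProbabilityMeasure μ] {B : ι → Set ℝ}
    (hB : ∀ i j, i ≠ j → Disjoint (B i) (B j)) (θ : ι → ℝ) {ν : Measure ℝ} {x : ℕ → ℝ}
    {m : ℕ} (hd : ∀ n, ν {x n} = 1) (hx : Function.Injective x) (hν : ν (Set.range x)ᶜ = 0)
    (hm : ∀ i, ∀ n ≥ m, x n ∉ B i) :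
    ∏ n ∈ Finset.range m, markCharFun μ (∑ i, (B i).indicator (fun _ => θ i) (x n)) =
      ∏ i, markCharFun μ (θ i) ^ count (ν (B i)) := by
  classical
  have h : ∀ i, ν (B i) = ((((Finset.range m).filter fun n => x n ∈ B i).card : ℕ) : ℝ≥0∞) := by
    intro i
    rw [measure_eq_sum_of_notMem hx hν (hm i), Finset.card_filter]
    push_cast
    refine Finset.sum_congr rfl fun n _ => ?_
    by_cases h : x n ∈ B i <;> simp [h, hd]
  have h' : ∀ y, markCharFun μ (∑ i, (B i).indicator (fun _ => θ i) y) =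
      ∏ i, if y ∈ B i then markCharFun μ (θ i) else 1 := by
    intro y
    by_cases hy : ∃ i, y ∈ B i
    · obtain ⟨i, hi⟩ := hy
      have hj : ∀ j, j ≠ i → y ∉ B j := fun j hj h => Set.disjoint_left.1 (hB j i hj) h hi
      rw [Finset.sum_eq_single i (fun j _ h => by simp [hj j h]) (by simp),
        Finset.prod_eq_single i (fun j _ h => by simp [hj j h]) (by simp)]
      simp [hi]
    · push Not at hy
      simp [hy]
  simp_rw [h', h, count_natCast]
  rw [Finset.prod_comm]
  refine Finset.prod_congr rfl fun i _ => ?_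
  rw [← Finset.prod_filter, Finset.prod_const]

variable {Ω : Type*} [MeasurableSpace Ω] {P : Measure Ω} {r : ℝ≥0}
  {N ξ : Ω → Measure ℝ} {μ : Measure ℕ}

theorem IsPoissonProcess.iIndepFun (hN : IsPoissonProcess r N P) {B : ι → Set ℝ}
    (hBm : ∀ i, MeasurableSet (B i)) (hB : ∀ i j, i ≠ j → Disjoint (B i) (B j)) :
    iIndepFun (fun i ω => N ω (B i)) P := by
  have e := Fintype.equivFin ι
  have h := hN.indep _ (fun k => B (e.symm k)) (fun k => hBm _)
    (fun i j hij => hB _ _ (fun h => hij (e.symm.injective h)))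
  have := h.precomp e.injective
  simpa using this

variable [IsProbabilityMeasure P] [IsProbabilityMeasure μ]

/-- The joint characteristic function of the total marks of disjoint sets. -/
theorem IsIIDMarking.integral_exp_sum (hξ : IsIIDMarking μ N ξ P) (hN : IsPoissonProcess r N P)
    {B : ι → Set ℝ} (hBm : ∀ i, MeasurableSet (B i)) (hBv : ∀ i, volume (B i) ≠ ∞)
    (hB : ∀ i j, i ≠ j → Disjoint (B i) (B j)) (θ : ι → ℝ) :
    ∫ ω, Complex.exp ((∑ i, θ i * (ξ ω (B i)).toReal : ℝ) * Complex.I) ∂P =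
      ∏ i, Complex.exp (r * (volume (B i)).toReal * (markCharFun μ (θ i) - 1)) := by
  obtain ⟨X, D, hX, hD, hXN, hξD, hlaw, hind, hND⟩ := hξ.exists_enumeration
  set τ : ℝ → ℝ := fun x => ∑ i, (B i).indicator (fun _ => θ i) x with hτdef
  have hτ : Measurable τ := Finset.measurable_sum _ fun i _ => measurable_const.indicator (hBm i)
  have hNm := hN.isPointProcess.measurable
  -- Almost surely only finitely many points lie in the sets `B i`, so both products over the first
  -- `m` points are eventually constant in `m`. Dominated convergence with bound `1` then passes to
  -- the limit on both sides of `integral_prod_marks`.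
  have hev : ∀ᵐ ω ∂P, ∀ᶠ m in Filter.atTop,
      (∏ n ∈ Finset.range m, Complex.exp ((τ (X n (N ω)) * D n ω : ℝ) * Complex.I) =
        Complex.exp ((∑ i, θ i * (ξ ω (B i)).toReal : ℝ) * Complex.I)) ∧
      (∏ n ∈ Finset.range m, markCharFun μ (τ (X n (N ω))) =
        ∏ i, markCharFun μ (θ i) ^ count (N ω (B i))) := by
    filter_upwards [hXN, hξD, hN.isPointProcess.isPointMeasure, hξ.isPointProcess.isPointMeasure,
      hξ.points_eq, hN.ae_simple, ae_all_iff.2 fun i => hN.ae_ne_top (hBm i) (hBv i)]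
      with ω hω hDω hNω hξω hpts hs hfin
    have h1 : ∀ᶠ n in Filter.atTop, ∀ i, X n (N ω) ∉ B i :=
      Filter.eventually_all.2 fun i => hNω.eventually_notMem hω.1 hω.2 (hfin i)
    obtain ⟨k, hk⟩ := Filter.eventually_atTop.1 h1
    filter_upwards [Filter.eventually_ge_atTop k] with m hm
    have hm' : ∀ i, ∀ n ≥ m, X n (N ω) ∉ B i := fun i n hn => hk n (hm.trans hn) i
    constructor
    · have e : ∑ n ∈ Finset.range m, τ (X n (N ω)) * D n ω = ∑ i, θ i * (ξ ω (B i)).toReal :=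
        sum_indicator_mul_eq θ hDω hω.1
          (by rw [hω.2, ← hpts]; exact hξω.measure_compl_points) hm'
      rw [← Complex.exp_sum, ← Finset.sum_mul, ← Complex.ofReal_sum, e]
    · refine prod_markCharFun_eq hB θ (fun n => le_antisymm (hs _) ?_) hω.1
        (by rw [hω.2]; exact hNω.measure_compl_points) hm'
      obtain ⟨j, hj⟩ := hNω {X n (N ω)} (measurableSet_singleton _) _ isCompact_singleton subset_rfl
      have hpos : 0 < N ω {X n (N ω)} := by
        have : X n (N ω) ∈ points (N ω) := hω.2 ▸ ⟨n, rfl⟩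
        exact this
      rw [hj] at hpos ⊢
      exact_mod_cast (by exact_mod_cast hpos : 0 < j)
  have hlim1 : Filter.Tendsto (fun m => ∫ ω, ∏ n ∈ Finset.range m,
      Complex.exp ((τ (X n (N ω)) * D n ω : ℝ) * Complex.I) ∂P) Filter.atTop
      (nhds (∫ ω, Complex.exp ((∑ i, θ i * (ξ ω (B i)).toReal : ℝ) * Complex.I) ∂P)) := by
    refine tendsto_integral_of_dominated_convergence (fun _ => 1) (fun m => ?_) (integrable_const _)
      (fun m => Filter.Eventually.of_forall fun ω => ?_) ?_
    · refine (Finset.measurable_prod _ fun n _ => ?_).aestronglyMeasurable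
      have h1 : Measurable fun ω => τ (X n (N ω)) := hτ.comp ((hX n).comp hNm)
      have h2 : Measurable fun ω => ((D n ω : ℕ) : ℝ) :=
        (measurable_from_nat (f := fun k : ℕ => (k : ℝ))).comp (hD n)
      exact Complex.measurable_exp.comp ((Complex.measurable_ofReal.comp (h1.mul h2)).mul_const _)
    · simp only [norm_prod, Complex.norm_exp_ofReal_mul_I, Finset.prod_const_one, le_refl]
    · filter_upwards [hev] with ω hω
      exact tendsto_const_nhds.congr' (hω.mono fun m h => h.1.symm)
  have hlim2 : Filter.Tendsto (fun m => ∫ ω, ∏ n ∈ Finset.range m,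
      markCharFun μ (τ (X n (N ω))) ∂P) Filter.atTop
      (nhds (∫ ω, ∏ i, markCharFun μ (θ i) ^ count (N ω (B i)) ∂P)) := by
    refine tendsto_integral_of_dominated_convergence (fun _ => 1) (fun m => ?_) (integrable_const _)
      (fun m => Filter.Eventually.of_forall fun ω => ?_) ?_
    · exact (Finset.measurable_prod _ fun n _ =>
        (measurable_markCharFun μ).comp (hτ.comp ((hX n).comp hNm))).aestronglyMeasurable
    · rw [norm_prod]
      exact Finset.prod_le_one (fun _ _ => norm_nonneg _) fun _ _ => norm_markCharFun_le _ _
    · filter_upwards [hev] with ω hω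
      exact tendsto_const_nhds.congr' (hω.mono fun m h => h.2.symm)
  simp_rw [integral_prod_marks hNm hX hD hlaw hind hND hτ] at hlim1
  rw [tendsto_nhds_unique hlim1 hlim2]
  have hpow : ∀ i, Measurable fun x : ℝ≥0∞ => markCharFun μ (θ i) ^ count x := fun i =>
    (measurable_from_nat (f := fun n => markCharFun μ (θ i) ^ n)).comp measurable_count
  rw [(hN.iIndepFun hBm hB).integral_fun_prod_comp (f := fun i x => markCharFun μ (θ i) ^ count x)
    (fun i => ((Measure.measurable_coe (hBm i)).comp hNm).aemeasurable)
    (fun i => (hpow i).aestronglyMeasurable)]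
  exact Finset.prod_congr rfl fun i _ => hN.integral_pow_count (hBm i) (hBv i) _

theorem IsIIDMarking.integral_exp (hξ : IsIIDMarking μ N ξ P) (hN : IsPoissonProcess r N P)
    {B : Set ℝ} (hBm : MeasurableSet B) (hBv : volume B ≠ ∞) (θ : ℝ) :
    ∫ ω, Complex.exp ((θ * (ξ ω B).toReal : ℝ) * Complex.I) ∂P =
      Complex.exp (r * (volume B).toReal * (markCharFun μ θ - 1)) := by
  have := hξ.integral_exp_sum hN (ι := Unit) (B := fun _ => B) (fun _ => hBm) (fun _ => hBv)
    (fun i j h => (h (Subsingleton.elim i j)).elim) (fun _ => θ)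
  simpa using this

/-- The total marks of disjoint sets are independent. -/
theorem IsIIDMarking.iIndepFun_toReal (hξ : IsIIDMarking μ N ξ P) (hN : IsPoissonProcess r N P)
    {B : ι → Set ℝ} (hBm : ∀ i, MeasurableSet (B i)) (hBv : ∀ i, volume (B i) ≠ ∞)
    (hB : ∀ i j, i ≠ j → Disjoint (B i) (B j)) :
    ProbabilityTheory.iIndepFun (fun i ω => (ξ ω (B i)).toReal) P := by
  have hm : ∀ i, Measurable fun ω => (ξ ω (B i)).toReal := fun i =>
    ((Measure.measurable_coe (hBm i)).comp hξ.isPointProcess.measurable).ennreal_toReal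
  -- Independence is equivalent to factorisation of the joint characteristic function, and the joint
  -- formula is a product of the one-set formulas.
  rw [iIndepFun_iff_charFun_pi fun i => (hm i).aemeasurable]
  intro t
  have h1 : Measurable fun ω => WithLp.toLp 2 fun i => (ξ ω (B i)).toReal :=
    (WithLp.measurable_toLp 2 _).comp (measurable_pi_lambda _ hm)
  rw [charFun_apply, integral_map h1.aemeasurable (by fun_prop)]
  simp_rw [PiLp.inner_apply, Real.inner_apply]
  simp_rw [mul_comm _ (t _)]
  rw [hξ.integral_exp_sum hN hBm hBv hB]
  refine Finset.prod_congr rfl fun i _ => ?_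
  rw [charFun_apply_real, integral_map (hm i).aemeasurable (by fun_prop), ← hξ.integral_exp hN (hBm i) (hBv i)]
  congr with ω
  push_cast
  rfl

theorem IsIIDMarking.iIndepFun_cell (hξ : IsIIDMarking μ N ξ P) (hN : IsPoissonProcess r N P)
    (n : ℕ) : ProbabilityTheory.iIndepFun (fun (j : ℤ) ω => (ξ ω (cell n j)).toReal) P := by
  rw [iIndepFun_iff_finset]
  intro s
  exact hξ.iIndepFun_toReal hN (B := fun j : s => cell n j) (fun j => measurableSet_cell n j)
    (fun j => by simp [volume_cell])
    (fun i j h => disjoint_cell n fun h' => h (Subtype.ext h'))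

end JointCharFun

/-! ### Masses of dyadic cells. -/

theorem measure_setOf_floor_mem (m : Measure ℝ) (n : ℕ) (s : Finset ℤ) :
    m ((fun x : ℝ => ⌊x * 2 ^ n⌋) ⁻¹' s) = ∑ j ∈ s, m (cell n j) := by
  rw [← measure_biUnion_finset (fun i _ j _ h => disjoint_cell n h)
    (fun j _ => measurableSet_cell n j)]
  congr 1
  ext x
  simp [mem_cell_iff]

theorem measure_Ico_dyadic (m : Measure ℝ) (n : ℕ) (a b : ℤ) :
    m (Set.Ico ((a : ℝ) / 2 ^ n) ((b : ℝ) / 2 ^ n)) = ∑ j ∈ Finset.Ico a b, m (cell n j) := by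
  rw [← measure_setOf_floor_mem]
  congr 1
  ext x
  have h : (0 : ℝ) < 2 ^ n := by positivity
  rw [Set.mem_preimage, Finset.coe_Ico, Set.mem_Ico, Set.mem_Ico, Int.le_floor, Int.floor_lt,
    div_le_iff₀ h, lt_div_iff₀ h]

theorem measure_cell_eq_add (m : Measure ℝ) (n : ℕ) (j : ℤ) :
    m (cell n j) = m (cell (n + 1) (2 * j)) + m (cell (n + 1) (2 * j + 1)) := by
  have h := measure_Ico_dyadic m (n + 1) (2 * j) (2 * j + 2)
  have hs : Finset.Ico (2 * j) (2 * j + 2) = {2 * j, 2 * j + 1} := by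
    ext x; simp; omega
  rw [hs, Finset.sum_pair (by omega)] at h
  rw [← h, cell]
  congr 2 <;> push_cast <;> rw [pow_succ] <;> field_simp

theorem mem_window_succ {n : ℕ} {j : ℤ} (hj : j ∈ window n) :
    2 * j ∈ window (n + 1) ∧ 2 * j + 1 ∈ window (n + 1) := by
  simp only [window, Finset.mem_Ico] at hj ⊢
  have h1 : ((n + 1 : ℕ) : ℤ) * 2 ^ (n + 1) = 2 * (n * 2 ^ n) + 2 * 2 ^ n := by push_cast; ring
  have h2 : (0 : ℤ) < 2 ^ n := by positivity
  rw [h1]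
  constructor <;> constructor <;> linarith

/-- The masses of the dyadic intervals of order `n` contained in `[-n, n)`. -/
noncomputable def localMass (n : ℕ) (m : Measure ℝ) (j : ℤ) : ℝ≥0∞ :=
  if j ∈ window n then m (cell n j) else 0

theorem measurable_localMass (n : ℕ) : Measurable (localMass n) := by
  refine measurable_pi_lambda _ fun j => ?_
  unfold localMass
  split_ifs
  · exact Measure.measurable_coe (measurableSet_cell n j)
  · exact measurable_const

/-- The restriction of measures to those which are finite on bounded sets. -/
noncomputable def truncate (m : Measure ℝ) : Measure ℝ :=
  open Classical in if ∀ k : ℕ, m (Set.Ico (-k : ℝ) k) < ∞ then m else 0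

theorem measurable_truncate : Measurable truncate := by
  refine Measurable.ite ?_ measurable_id measurable_const
  rw [show {m : Measure ℝ | ∀ k : ℕ, m (Set.Ico (-k : ℝ) k) < ∞} =
    ⋂ k : ℕ, (fun m : Measure ℝ => m (Set.Ico (-k : ℝ) k)) ⁻¹' Set.Iio ∞ by ext; simp]
  exact MeasurableSet.iInter fun _ => Measure.measurable_coe measurableSet_Ico measurableSet_Iio

theorem truncate_Ico_lt_top (m : Measure ℝ) (k : ℕ) : truncate m (Set.Ico (-k : ℝ) k) < ∞ := by
  unfold truncate
  split_ifs with h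
  · exact h k
  · simp

/-- Point processes are locally finite only almost surely. Truncation gives versions that are so for
every `ω`, as the pointwise measurability argument below requires. -/
theorem IsPointMeasure.truncate_eq {m : Measure ℝ} (hm : IsPointMeasure m) : truncate m = m :=
  if_pos fun _ => hm.measure_Ico_lt_top _ _

/-- Half-lines are exhausted by unions of dyadic cells. The shift by `k` keeps the order at least
`k`, so that the cells inside `[-k, k)` belong to the window. -/
theorem iUnion_floor_lt (x : ℝ) (k : ℕ) :
    (⋃ n : ℕ, {y : ℝ | ⌊y * 2 ^ (n + k)⌋ < ⌊x * 2 ^ (n + k)⌋}) = Set.Iio x := by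
  ext y
  simp only [Set.mem_iUnion, Set.mem_ofPred_eq, Set.mem_Iio]
  constructor
  · rintro ⟨n, hn⟩
    by_contra! h
    exact hn.not_ge (Int.floor_le_floor (by gcongr))
  · intro h
    obtain ⟨n, hn⟩ := pow_unbounded_of_one_lt (1 / (x - y)) (one_lt_two)
    refine ⟨n, ?_⟩
    have h0 : 0 < x - y := by linarith
    have h1 : (2 : ℝ) ^ n ≤ 2 ^ (n + k) := pow_le_pow_right₀ (by norm_num) (by omega)
    rw [div_lt_iff₀ h0] at hn
    rw [Int.lt_iff_add_one_le, Int.le_floor]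
    push_cast
    have := Int.floor_le (y * 2 ^ (n + k))
    nlinarith

theorem monotone_floor_lt (x : ℝ) (k : ℕ) :
    Monotone fun n : ℕ => {y : ℝ | ⌊y * 2 ^ (n + k)⌋ < ⌊x * 2 ^ (n + k)⌋} := by
  refine monotone_nat_of_le_succ fun n y hy => ?_
  simp only [Set.mem_ofPred_eq] at hy ⊢
  have h1 := Int.floor_lt.1 hy
  have h2 := Int.floor_le (x * 2 ^ (n + k))
  have e : ∀ z : ℝ, z * 2 ^ (n + 1 + k) = 2 * (z * 2 ^ (n + k)) := fun z => by ring
  rw [e, e]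
  refine lt_of_lt_of_le (b := 2 * ⌊x * 2 ^ (n + k)⌋) (Int.floor_lt.2 ?_) (Int.le_floor.2 ?_)
  · push_cast; linarith
  · push_cast; linarith

/-! ### Approximation by dyadic masses. -/

section Filtration

variable {Ω : Type*} {mΩ : MeasurableSpace Ω} {N ξ : Ω → Measure ℝ}

/-- A measure which is finite on bounded sets is measurable with respect to the masses of dyadic
intervals. -/
theorem measurable_of_measurable_cell (hfin : ∀ ω (k : ℕ), N ω (Set.Ico (-k : ℝ) k) < ∞)
    (h : ∀ n, ∀ j ∈ window n, Measurable fun ω => N ω (cell n j)) : Measurable N := by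
  have hsub : ∀ (k n : ℕ), k ≤ n → ∀ j ∈ Finset.Ico (-(k * 2 ^ n) : ℤ) (k * 2 ^ n), j ∈ window n := by
    intro k n hkn j hj
    rw [window]
    have : (k : ℤ) * 2 ^ n ≤ n * 2 ^ n := by gcongr
    rw [Finset.mem_Ico] at hj ⊢
    constructor <;> linarith
  have hfloor : ∀ k n : ℕ, Set.Ico (-k : ℝ) k =
      (fun x : ℝ => ⌊x * 2 ^ n⌋) ⁻¹' (Finset.Ico (-(k * 2 ^ n) : ℤ) (k * 2 ^ n) : Finset ℤ) := by
    intro k n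
    ext x
    have h : (0 : ℝ) < 2 ^ n := by positivity
    rw [Set.mem_preimage, Finset.coe_Ico, Set.mem_Ico, Set.mem_Ico, Int.le_floor, Int.floor_lt]
    push_cast
    rw [← neg_mul, mul_le_mul_iff_left₀ h, mul_lt_mul_iff_left₀ h]
  -- On `[-k, k)` the measures are finite, so it suffices to test the π-system of half-lines and the
  -- total mass.
  have hrestr : ∀ k : ℕ, Measurable fun ω => (N ω).restrict (Set.Ico (-k : ℝ) k) := by
    intro k
    have : ∀ ω, IsFiniteMeasure ((N ω).restrict (Set.Ico (-k : ℝ) k)) := fun ω =>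
      isFiniteMeasure_restrict.2 (hfin ω k).ne
    refine Measurable.measure_of_isPiSystem (S := Set.range Set.Iio)
      (by rw [← borel_eq_generateFrom_Iio]; exact BorelSpace.measurable_eq) isPiSystem_Iio ?_ ?_
    · rintro _ ⟨x, rfl⟩
      have heq : ∀ ω, (N ω).restrict (Set.Ico (-k : ℝ) k) (Set.Iio x) =
          ⨆ n : ℕ, ∑ j ∈ (Finset.Ico (-(k * 2 ^ (n + k)) : ℤ) (k * 2 ^ (n + k))).filter
            (fun j => j < ⌊x * 2 ^ (n + k)⌋), N ω (cell (n + k) j) := by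
        intro ω
        rw [← iUnion_floor_lt x k, (monotone_floor_lt x k).measure_iUnion]
        congr with n
        rw [← measure_setOf_floor_mem, Measure.restrict_apply' measurableSet_Ico, hfloor k (n + k)]
        congr 1
        ext y
        simp only [Set.mem_inter_iff, Set.mem_ofPred_eq, Set.mem_preimage, Finset.coe_Ico,
          Set.mem_Ico, Finset.coe_filter, Finset.mem_Ico]
        tauto
      simp_rw [heq]
      refine Measurable.iSup fun n => Finset.measurable_sum _ fun j hj => h _ _ ?_
      exact hsub k _ (by omega) j (Finset.mem_filter.1 hj).1
    · simp_rw [Measure.restrict_apply_univ, hfloor k k, measure_setOf_floor_mem]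
      exact Finset.measurable_sum _ fun j hj => h _ _ (hsub k k le_rfl j hj)
  refine Measure.measurable_of_measurable_coe _ fun B hB => ?_
  have heq : ∀ ω, N ω B = ⨆ k : ℕ, (N ω).restrict (Set.Ico (-k : ℝ) k) B := by
    intro ω
    simp_rw [Measure.restrict_apply hB]
    rw [← Monotone.measure_iUnion, ← Set.inter_iUnion]
    · congr 1
      rw [eq_comm, Set.inter_eq_left]
      intro x _
      obtain ⟨k, hk⟩ := exists_nat_gt |x|
      obtain ⟨h1, h2⟩ := abs_lt.1 hk
      exact Set.mem_iUnion.2 ⟨k, h1.le, h2⟩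
    · intro i j hij
      have : (i : ℝ) ≤ j := by exact_mod_cast hij
      exact Set.inter_subset_inter_right _ (Set.Ico_subset_Ico (by linarith) this)
  simp_rw [heq]
  exact Measurable.iSup fun k => (Measure.measurable_coe hB).comp (hrestr k)

/-- The σ-algebras generated by the masses of dyadic intervals. -/
noncomputable def localFiltration (hN : Measurable N) (hξ : Measurable ξ) : Filtration ℕ mΩ where
  seq n := MeasurableSpace.comap (fun ω => (localMass n (N ω), localMass n (ξ ω))) inferInstance
  mono' := by
    refine monotone_nat_of_le_succ fun n => ?_
    rw [← measurable_iff_comap_le]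
    have key : ∀ (K : Ω → Measure ℝ) (m' : MeasurableSpace Ω),
        (Measurable[m'] fun ω => localMass (n + 1) (K ω)) →
          Measurable[m'] fun ω => localMass n (K ω) := by
      intro K m' hK
      refine measurable_pi_lambda _ fun j => ?_
      unfold localMass
      split_ifs with hj
      · have e : (fun ω => K ω (cell n j)) = fun ω => K ω (cell (n + 1) (2 * j)) +
            K ω (cell (n + 1) (2 * j + 1)) := funext fun ω => measure_cell_eq_add _ n j
        rw [e]
        have h : ∀ i ∈ window (n + 1), Measurable[m'] fun ω => K ω (cell (n + 1) i) := by
          intro i hi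
          have := (measurable_pi_apply i).comp hK
          simpa [Function.comp_def, localMass, hi] using this
        exact (h _ (mem_window_succ hj).1).add (h _ (mem_window_succ hj).2)
      · exact measurable_const
    have hc := comap_measurable (m := inferInstance) (fun ω => (localMass (n + 1) (N ω), localMass (n + 1) (ξ ω)))
    exact (key N _ (measurable_fst.comp hc)).prodMk (key ξ _ (measurable_snd.comp hc))
  le' n := measurable_iff_comap_le.1
    (((measurable_localMass n).comp hN).prodMk ((measurable_localMass n).comp hξ))

theorem measurable_iSup_localFiltration (hN : Measurable N) (hξ : Measurable ξ)
    (hNfin : ∀ ω (k : ℕ), N ω (Set.Ico (-k : ℝ) k) < ∞)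
    (hξfin : ∀ ω (k : ℕ), ξ ω (Set.Ico (-k : ℝ) k) < ∞) :
    Measurable[⨆ n, localFiltration hN hξ n] fun ω => (N ω, ξ ω) := by
  have hc : ∀ n, Measurable[⨆ n, localFiltration hN hξ n]
      fun ω => (localMass n (N ω), localMass n (ξ ω)) := fun n =>
    (comap_measurable (fun ω => (localMass n (N ω), localMass n (ξ ω)))).mono
      (le_iSup (fun n => localFiltration hN hξ n) n) le_rfl
  have key : ∀ (K : Ω → Measure ℝ) (m' : MeasurableSpace Ω),
      (∀ n, Measurable[m'] fun ω => localMass n (K ω)) →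
        ∀ n, ∀ j ∈ window n, Measurable[m'] fun ω => K ω (cell n j) := by
    intro K m' hK n j hj
    have := (measurable_pi_apply j).comp (hK n)
    simpa [Function.comp_def, localMass, hj] using this
  refine Measurable.prodMk ?_ ?_
  · exact measurable_of_measurable_cell hNfin (key N _ fun n => measurable_fst.comp (hc n))
  · exact measurable_of_measurable_cell hξfin (key ξ _ fun n => measurable_snd.comp (hc n))

/-- Functions of a pair of point processes are approximated by functions of the masses of dyadic
intervals. -/
theorem exists_tendsto_localMass {P : Measure Ω} [IsProbabilityMeasure P]
    (hN : IsPointProcess N P) (hξ : IsPointProcess ξ P) {f : Measure ℝ × Measure ℝ → ℝ}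
    (hf : Measurable f) (hf1 : ∀ p, |f p| ≤ 1) :
    ∃ g : ℕ → (ℤ → ℝ≥0∞) × (ℤ → ℝ≥0∞) → ℝ, (∀ n, Measurable (g n)) ∧ (∀ n p, |g n p| ≤ 1) ∧
      Filter.Tendsto (fun n => ∫ ω, |f (N ω, ξ ω) - g n (localMass n (N ω), localMass n (ξ ω))| ∂P)
        Filter.atTop (nhds 0) := by
  set N' : Ω → Measure ℝ := fun ω => truncate (N ω)
  set ξ' : Ω → Measure ℝ := fun ω => truncate (ξ ω)
  have hN' : Measurable N' := measurable_truncate.comp hN.measurable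
  have hξ' : Measurable ξ' := measurable_truncate.comp hξ.measurable
  set h : Ω → ℝ := fun ω => f (N' ω, ξ' ω)
  have hhm : Measurable h := hf.comp (hN'.prodMk hξ')
  have hint : Integrable h P := Integrable.of_bound hhm.aestronglyMeasurable 1
    (Filter.Eventually.of_forall fun ω => hf1 _)
  have hhs : StronglyMeasurable[⨆ n, localFiltration hN' hξ' n] h :=
    (hf.comp (measurable_iSup_localFiltration hN' hξ' (fun ω k => truncate_Ico_lt_top _ k)
      (fun ω k => truncate_Ico_lt_top _ k))).stronglyMeasurable
  -- Lévy's upward theorem in `L¹`; each conditional expectation then factors through the dyadic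
  -- masses.
  have hlim := hint.tendsto_eLpNorm_condExp hhs
  have hex : ∀ n, ∃ G : (ℤ → ℝ≥0∞) × (ℤ → ℝ≥0∞) → ℝ, Measurable G ∧
      P[h | localFiltration hN' hξ' n] = G ∘ fun ω => (localMass n (N' ω), localMass n (ξ' ω)) :=
    fun n => (stronglyMeasurable_condExp (f := h) (μ := P)
      (m := localFiltration hN' hξ' n)).measurable.exists_eq_measurable_comp
  choose G hGm hG using hex
  -- Clamping to `[-1, 1]`, where `f` takes its values, does not increase the error.
  refine ⟨fun n p => max (-1) (min 1 (G n p)), fun n => by fun_prop, fun n p => ?_, ?_⟩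
  · exact abs_le.2 ⟨le_max_left _ _, max_le (by norm_num) (min_le_left _ _)⟩
  · have hlim' := (ENNReal.tendsto_toReal ENNReal.zero_ne_top).comp hlim
    refine squeeze_zero (fun n => integral_nonneg fun ω => abs_nonneg _) (fun n => ?_) hlim'
    have hi : Integrable (fun ω => ‖(P[h | localFiltration hN' hξ' n] - h) ω‖) P :=
      (integrable_condExp.sub hint).norm
    rw [Function.comp_apply, eLpNorm_one_eq_lintegral_enorm, ← integral_norm_eq_lintegral_enorm
      (integrable_condExp.sub hint).aestronglyMeasurable]
    refine integral_mono_of_nonneg (Filter.Eventually.of_forall fun ω => abs_nonneg _) hi ?_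
    filter_upwards [hN.isPointMeasure, hξ.isPointMeasure] with ω h1 h2
    have e1 : N' ω = N ω := h1.truncate_eq
    have e2 : ξ' ω = ξ ω := h2.truncate_eq
    rw [Pi.sub_apply, hG n, Function.comp_apply, Real.norm_eq_abs,
      show h ω = f (N ω, ξ ω) by rw [← e1, ← e2], e1, e2]
    have hb := abs_le.1 (hf1 (N ω, ξ ω))
    rw [abs_sub_comm]
    generalize G n _ = y
    generalize f _ = z at hb ⊢
    have hz : z = max (-1) (min 1 z) := by
      rw [min_eq_right hb.2, max_eq_right hb.1]
    conv_lhs => rw [hz]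
    exact (abs_max_sub_max_le_max _ _ _ _).trans (max_le (by simp)
      ((abs_min_sub_min_le_max _ _ _ _).trans (max_le (by simp) le_rfl)))

end Filtration

/-! ### Reduction to the marks, and decay of the expected parity. -/

section Decorrelation

variable {Ω : Type*} [MeasurableSpace Ω] {P : Measure Ω} [IsProbabilityMeasure P] {r : ℝ≥0}
  {N ξ : Ω → Measure ℝ} {μ : Measure ℕ}

/-- Functions of a marked Poisson process are approximated by functions of the total marks of dyadic
intervals. -/
theorem IsIIDMarking.exists_tendsto_localMass (hξ : IsIIDMarking μ N ξ P)
    (hN : IsPoissonProcess r N P) {f : Measure ℝ × Measure ℝ → ℝ}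
    (hf : Measurable f) (hf1 : ∀ p, |f p| ≤ 1) :
    ∃ g : ℕ → (ℤ → ℝ≥0∞) → ℝ, (∀ n, Measurable (g n)) ∧ (∀ n p, |g n p| ≤ 1) ∧
      Filter.Tendsto (fun n => ∫ ω, |f (N ω, ξ ω) - g n (localMass n (ξ ω))| ∂P)
        Filter.atTop (nhds 0) := by
  obtain ⟨g, hgm, hg1, hlim⟩ :=
    PoissonMatching.exists_tendsto_localMass hN.isPointProcess hξ.isPointProcess hf hf1
  have hNm := hN.isPointProcess.measurable
  have hξm := hξ.isPointProcess.measurable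
  -- Off the crowded event a cell of the window contains at most one point, and contains one exactly
  -- when its total mark is nonzero; thus `supp` recovers the masses of `N` from those of `ξ`. The
  -- crowded event costs at most twice its probability.
  set supp : (ℤ → ℝ≥0∞) → ℤ → ℝ≥0∞ := fun y j => if y j = 0 then 0 else 1 with hsupp
  have hsm : Measurable supp := measurable_pi_lambda _ fun j =>
    Measurable.ite (measurable_pi_apply j (measurableSet_singleton _)) measurable_const
      measurable_const
  have hg'm : ∀ n, Measurable fun y => g n (supp y, y) := fun n =>
    (hgm n).comp (hsm.prodMk measurable_id)
  refine ⟨fun n y => g n (supp y, y), hg'm, fun n y => hg1 n _, ?_⟩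
  have hcm : ∀ n, MeasurableSet (crowded N n) := fun n =>
    Finset.measurableSet_biUnion _ fun j _ =>
      ((Measure.measurable_coe (measurableSet_cell n j)).comp hNm) measurableSet_Ioi
  have hcr : Filter.Tendsto (fun n => 2 * P.real (crowded N n)) Filter.atTop (nhds 0) := by
    have := ((ENNReal.tendsto_toReal ENNReal.zero_ne_top).comp
      hN.tendsto_measure_crowded).const_mul (2 : ℝ)
    simpa [Function.comp_def, Measure.real] using this
  refine squeeze_zero (fun n => integral_nonneg fun ω => abs_nonneg _) (fun n => ?_)
    (by simpa using hlim.add hcr)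
  have hi : Integrable (fun ω => |f (N ω, ξ ω) - g n (localMass n (N ω), localMass n (ξ ω))|) P := by
    refine Integrable.of_bound (Measurable.aestronglyMeasurable ?_) 2
      (Filter.Eventually.of_forall fun ω => ?_)
    · have h1 := hf.comp (hNm.prodMk hξm)
      have h2 := (hgm n).comp (((measurable_localMass n).comp hNm).prodMk
        ((measurable_localMass n).comp hξm))
      exact continuous_abs.measurable.comp (h1.sub h2)
    · rw [Real.norm_eq_abs, abs_abs]
      exact (abs_sub _ _).trans (by linarith [hf1 (N ω, ξ ω), hg1 n (localMass n (N ω), localMass n (ξ ω))])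
  have hi2 : Integrable ((crowded N n).indicator fun _ => (2 : ℝ)) P :=
    (integrable_const _).indicator (hcm n)
  have e : ∫ ω, |f (N ω, ξ ω) - g n (localMass n (N ω), localMass n (ξ ω))| ∂P +
      2 * P.real (crowded N n) = ∫ ω, (|f (N ω, ξ ω) - g n (localMass n (N ω), localMass n (ξ ω))| +
        (crowded N n).indicator (fun _ => (2 : ℝ)) ω) ∂P := by
    rw [integral_add hi hi2, integral_indicator_const _ (hcm n), smul_eq_mul, mul_comm (2 : ℝ)]
  rw [e]
  refine integral_mono_of_nonneg (Filter.Eventually.of_forall fun ω => abs_nonneg _) (hi.add hi2) ?_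
  filter_upwards [hN.isPointProcess.isPointMeasure, hξ.isPointProcess.isPointMeasure, hξ.points_eq]
    with ω h1 h2 hpts
  by_cases hc : ω ∈ crowded N n
  · simp only [Set.indicator_of_mem hc]
    have := abs_sub (f (N ω, ξ ω)) (g n (supp (localMass n (ξ ω)), localMass n (ξ ω)))
    have h3 := abs_nonneg (f (N ω, ξ ω) - g n (localMass n (N ω), localMass n (ξ ω)))
    linarith [hf1 (N ω, ξ ω), hg1 n (supp (localMass n (ξ ω)), localMass n (ξ ω))]
  · have hs : supp (localMass n (ξ ω)) = localMass n (N ω) := by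
      funext j
      simp only [hsupp, localMass]
      by_cases hj : j ∈ window n
      · have hle : N ω (cell n j) ≤ 1 := by
          by_contra! h
          exact hc (Set.mem_biUnion hj h)
        have hz : ξ ω (cell n j) = 0 ↔ N ω (cell n j) = 0 := by
          rw [h2.measure_eq_zero_iff, h1.measure_eq_zero_iff, hpts]
        simp only [hj, if_true, hz]
        obtain ⟨k, hk⟩ := h1.exists_nat (measurableSet_cell n j) (hle.trans_lt ENNReal.one_lt_top).ne
        rw [hk] at hle ⊢
        have hk1 : k ≤ 1 := by exact_mod_cast hle
        interval_cases k <;> simp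
      · simp [hj]
    simp [hs, Set.indicator_of_notMem hc]

variable [IsProbabilityMeasure μ]

/-- The real part at `π` is the mean of `(-1) ^ k`, which an odd atom pulls strictly below `1`. -/
theorem re_markCharFun_pi_lt_one (hμ : ∃ k : ℕ, Odd k ∧ 0 < μ {k}) :
    (markCharFun μ Real.pi).re < 1 := by
  obtain ⟨k, hk, hμk⟩ := hμ
  have hint : Integrable (fun k : ℕ => Complex.exp ((Real.pi * k : ℝ) * Complex.I)) μ :=
    Integrable.of_bound measurable_from_nat.aestronglyMeasurable 1
      (Filter.Eventually.of_forall fun k => (Complex.norm_exp_ofReal_mul_I _).le)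
  have hre : (markCharFun μ Real.pi).re = ∫ k : ℕ, Real.cos (Real.pi * k) ∂μ := by
    have h := integral_re hint
    rw [markCharFun]
    refine Eq.trans h.symm ?_
    congr with k
    exact Complex.exp_ofReal_mul_I_re _
  have hcos : Integrable (fun k : ℕ => Real.cos (Real.pi * k)) μ :=
    Integrable.of_bound measurable_from_nat.aestronglyMeasurable 1
      (Filter.Eventually.of_forall fun k => Real.abs_cos_le_one _)
  have hpos : 0 < ∫ k : ℕ, (1 - Real.cos (Real.pi * k)) ∂μ := by
    rw [integral_pos_iff_support_of_nonneg (f := fun k : ℕ => 1 - Real.cos (Real.pi * k))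
      (fun k => by simp only [Pi.zero_apply]; linarith [Real.cos_le_one (Real.pi * k)])
      ((integrable_const _).sub hcos)]
    refine hμk.trans_le (measure_mono (Set.singleton_subset_iff.2 ?_))
    rw [Function.mem_support, mul_comm, Real.cos_nat_mul_pi, hk.neg_one_pow]
    norm_num
  rw [integral_sub (integrable_const _) hcos] at hpos
  simp at hpos
  rw [hre]
  exact hpos

theorem IsIIDMarking.iIndepFun_cell_ennreal (hξ : IsIIDMarking μ N ξ P)
    (hN : IsPoissonProcess r N P) (n : ℕ) : iIndepFun (fun (j : ℤ) ω => ξ ω (cell n j)) P := by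
  have h := (hξ.iIndepFun_cell hN n).comp (fun _ => ENNReal.ofReal)
    (fun _ => ENNReal.measurable_ofReal)
  refine h.congr fun j => ?_
  filter_upwards [hξ.isPointProcess.isPointMeasure] with ω hω
  exact ENNReal.ofReal_toReal (hω.measure_Ico_lt_top _ _).ne

/-- The parity is the real part of `exp (iπ ξ)`, so the bound is the modulus of the compound Poisson
characteristic function at `π`. -/
theorem IsIIDMarking.abs_integral_parity_le (hξ : IsIIDMarking μ N ξ P)
    (hN : IsPoissonProcess r N P) (a b : ℝ) (hab : a ≤ b) :
    |∫ ω, parity (ξ ω (Set.Ico a b)) ∂P| ≤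
      Real.exp (r * (b - a) * ((markCharFun μ Real.pi).re - 1)) := by
  have h := hξ.integral_exp hN (B := Set.Ico a b) measurableSet_Ico (by simp) Real.pi
  have hm : Measurable fun ω => (ξ ω (Set.Ico a b)).toReal :=
    ((Measure.measurable_coe measurableSet_Ico).comp hξ.isPointProcess.measurable).ennreal_toReal
  have hint : Integrable (fun ω => Complex.exp ((Real.pi * (ξ ω (Set.Ico a b)).toReal : ℝ) *
      Complex.I)) P :=
    Integrable.of_bound (Complex.measurable_exp.comp ((Complex.measurable_ofReal.comp
      (hm.const_mul _)).mul_const _)).aestronglyMeasurable 1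
      (Filter.Eventually.of_forall fun ω => (Complex.norm_exp_ofReal_mul_I _).le)
  have e : ∫ ω, parity (ξ ω (Set.Ico a b)) ∂P = (∫ ω, Complex.exp
      ((Real.pi * (ξ ω (Set.Ico a b)).toReal : ℝ) * Complex.I) ∂P).re := by
    refine Eq.trans ?_ (integral_re hint)
    refine integral_congr_ae ?_
    filter_upwards [hξ.isPointProcess.isPointMeasure] with ω hω
    rw [parity, if_neg (hω.measure_Ico_lt_top _ _).ne]
    exact (Complex.exp_ofReal_mul_I_re _).symm
  rw [e, h]
  refine (Complex.abs_re_le_norm _).trans ?_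
  rw [Complex.norm_exp, Real.volume_Ico, ENNReal.toReal_ofReal (by linarith)]
  refine le_of_eq ?_
  congr 1
  rw [← Complex.ofReal_mul, Complex.re_ofReal_mul]
  simp

/-- Conditioning on the marks outside an interval does not change the expected parity inside. -/
theorem IsIIDMarking.abs_integral_mul_parity_le (hξ : IsIIDMarking μ N ξ P)
    (hN : IsPoissonProcess r N P) (n : ℕ) {i l : ℤ} (hil : i ≤ l) {f : (ℤ → ℝ≥0∞) → ℝ}
    (hf : Measurable f) (hf1 : ∀ y, |f y| ≤ 1) :
    |∫ ω, f (fun j => if j ∈ Finset.Ico i l then 0 else ξ ω (cell n j)) *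
        parity (∑ j ∈ Finset.Ico i l, ξ ω (cell n j)) ∂P| ≤
      Real.exp (r * ((l - i : ℝ) / 2 ^ n) * ((markCharFun μ Real.pi).re - 1)) := by
  have hξc : ∀ j, Measurable fun ω => ξ ω (cell n j) := fun j =>
    (Measure.measurable_coe (measurableSet_cell n j)).comp hξ.isPointProcess.measurable
  set mj : ℤ → MeasurableSpace Ω := fun j => MeasurableSpace.comap (fun ω => ξ ω (cell n j)) inferInstance
  have hle : ∀ j, mj j ≤ ‹MeasurableSpace Ω› := fun j => (hξc j).comap_le
  -- With the inner cells set to `0`, the factor `f` depends only on the outer cells, hence is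
  -- independent of the parity inside.
  have hind : Indep (⨆ j ∈ (Finset.Ico i l : Set ℤ)ᶜ, mj j) (⨆ j ∈ (Finset.Ico i l : Set ℤ), mj j) P :=
    indep_iSup_of_disjoint hle (hξ.iIndepFun_cell_ennreal hN n) disjoint_compl_left
  have hmj : ∀ (S : Set ℤ), ∀ j ∈ S, Measurable[⨆ j ∈ S, mj j] fun ω => ξ ω (cell n j) :=
    fun S j hj => (comap_measurable (m := inferInstance) (fun ω => ξ ω (cell n j))).mono
      (le_iSup₂ (f := fun j (_ : j ∈ S) => mj j) j hj) le_rfl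
  have h1 : Measurable[⨆ j ∈ (Finset.Ico i l : Set ℤ)ᶜ, mj j]
      fun ω => f (fun j => if j ∈ Finset.Ico i l then 0 else ξ ω (cell n j)) := by
    have hpi : ∀ m' : MeasurableSpace Ω,
        (∀ j ∉ Finset.Ico i l, Measurable[m'] fun ω => ξ ω (cell n j)) →
        Measurable[m'] fun ω j => if j ∈ Finset.Ico i l then 0 else ξ ω (cell n j) := by
      intro m' h
      refine measurable_pi_lambda _ fun j => ?_
      by_cases hj : j ∈ Finset.Ico i l
      · simp only [hj, if_true]; exact measurable_const
      · simp only [hj, if_false]; exact h j hj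
    exact hf.comp (hpi _ fun j hj => hmj _ j (by simpa using hj))
  have h2 : Measurable[⨆ j ∈ (Finset.Ico i l : Set ℤ), mj j]
      fun ω => parity (∑ j ∈ Finset.Ico i l, ξ ω (cell n j)) :=
    measurable_parity.comp (Finset.measurable_sum _ fun j hj => hmj _ j (by simpa using hj))
  have hindf : IndepFun (fun ω => f (fun j => if j ∈ Finset.Ico i l then 0 else ξ ω (cell n j)))
      (fun ω => parity (∑ j ∈ Finset.Ico i l, ξ ω (cell n j))) P := by
    rw [IndepFun_iff_Indep]
    exact indep_of_indep_of_le_left (indep_of_indep_of_le_right hind h2.comap_le) h1.comap_le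
  rw [hindf.integral_fun_mul_eq_mul_integral
    (h1.mono (iSup₂_le fun j _ => hle j) le_rfl).aestronglyMeasurable
    (h2.mono (iSup₂_le fun j _ => hle j) le_rfl).aestronglyMeasurable, abs_mul]
  have hf' : |∫ ω, f (fun j => if j ∈ Finset.Ico i l then 0 else ξ ω (cell n j)) ∂P| ≤ 1 := by
    have := norm_integral_le_of_norm_le_const (μ := P) (C := 1)
      (f := fun ω => f (fun j => if j ∈ Finset.Ico i l then 0 else ξ ω (cell n j)))
      (Filter.Eventually.of_forall fun ω => hf1 _)
    simpa using this
  have h2pos : (0 : ℝ) < 2 ^ n := by positivity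
  have hp := hξ.abs_integral_parity_le hN (i / 2 ^ n) (l / 2 ^ n)
    (by gcongr)
  simp_rw [measure_Ico_dyadic, ← sub_div] at hp
  calc _ ≤ 1 * |∫ ω, parity (∑ j ∈ Finset.Ico i l, ξ ω (cell n j)) ∂P| := by gcongr
    _ ≤ _ := by rw [one_mul]; exact hp

end Decorrelation

/-! ### The cut at the origin is infinite. -/

section Cut

variable {Ω : Type*} [MeasurableSpace Ω] {P : Measure Ω} {r : ℝ≥0}
  {N ξ : Ω → Measure ℝ} {M : Ω → Measure (Sym2 ℝ)} {μ : Measure ℕ}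

theorem measurable_localMass_degreeMeasure (n : ℕ) :
    Measurable fun m : Measure (Sym2 ℝ) => localMass n (degreeMeasure m) := by
  refine measurable_pi_lambda _ fun j => ?_
  unfold localMass
  split_ifs
  · exact measurable_degreeMeasure_apply (measurableSet_cell n j)
  · exact measurable_const

/-- Since `ξ` is a function of `M`, invariance of the law of `M` alone makes the pair `(M, ξ)`
invariant. -/
theorem IsMatchingScheme.ae_degreeMeasure_eq (hM : IsMatchingScheme N ξ M P)
    (hξ : IsIIDMarking μ N ξ P) : ∀ᵐ ω ∂P, degreeMeasure (M ω) = ξ ω := by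
  filter_upwards [hM.isPointProcess.isPointMeasure, hξ.isPointProcess.isPointMeasure,
    hξ.points_eq, hM.endpoints, hM.degree] with ω h1 h2 h3 h4 h5
  exact degreeMeasure_eq h1 h2 h3 h4 h5

theorem preimage_add_cell (n : ℕ) (j : ℤ) (T : ℕ) :
    (fun x : ℝ => x + (-(T : ℝ))) ⁻¹' cell n j = cell n (j + T * 2 ^ n) := by
  ext x
  rw [Set.mem_preimage, mem_cell_iff, mem_cell_iff]
  have : (x + -(T : ℝ)) * 2 ^ n = x * 2 ^ n - ((T * 2 ^ n : ℤ) : ℝ) := by push_cast; ring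
  rw [this, Int.floor_sub_intCast, sub_eq_iff_eq_add]

variable [IsProbabilityMeasure P] [IsProbabilityMeasure μ]

/-- If the parity of the cut at the origin is well approximated by a function of the marks in
`[-n, n)`, the cut is rarely finite. -/
theorem measureReal_cut_le (hr : 0 < r) (hμ : ∃ k : ℕ, Odd k ∧ 0 < μ {k})
    (hN : IsPoissonProcess r N P) (hξ : IsIIDMarking μ N ξ P) (hM : IsMatchingScheme N ξ M P)
    (hinv : IsTranslationInvariant M P) (n : ℕ) {g : (ℤ → ℝ≥0∞) → ℝ} (hg : Measurable g)
    (hg1 : ∀ y, |g y| ≤ 1) :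
    P.real {ω | cut (M ω) 0 < ∞} ≤
      2 * ∫ ω, |parity (cut (M ω) 0) - g (localMass n (ξ ω))| ∂P := by
  have hMm := hM.isPointProcess.measurable
  have hξm := hξ.isPointProcess.measurable
  have hdeg := hM.ae_degreeMeasure_eq hξ
  have hξc : ∀ j, Measurable fun ω => ξ ω (cell n j) := fun j =>
    (Measure.measurable_coe (measurableSet_cell n j)).comp hξm
  set δ := ∫ ω, |parity (cut (M ω) 0) - g (localMass n (ξ ω))| ∂P with hδ
  -- the masses of the dyadic intervals near `T`, seen from `T`
  set sh : ℕ → (ℤ → ℝ≥0∞) → ℤ → ℝ≥0∞ := fun T y j =>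
    if j ∈ window n then y (j + T * 2 ^ n) else 0 with hsh
  have hshm : ∀ T, Measurable (sh T) := by
    intro T
    refine measurable_pi_lambda _ fun j => ?_
    simp only [hsh]
    split_ifs
    · exact measurable_pi_apply _
    · exact measurable_const
  have hsh0 : ∀ ω, sh 0 (fun j => ξ ω (cell n j)) = localMass n (ξ ω) := by
    intro ω
    funext j
    simp [hsh, localMass]
  -- The error is the mean of a functional of `M` alone, with `ξ` read as its degree measure, so
  -- translating by `-T` leaves it unchanged.
  have hshift : ∀ T : ℕ, ∫ ω, |parity (cut (M ω) T) - g (sh T fun j => ξ ω (cell n j))| ∂P = δ := by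
    intro T
    set φ : Measure (Sym2 ℝ) → ℝ := fun m =>
      |parity (cut m 0) - g (localMass n (degreeMeasure m))| with hφ
    have hφm : Measurable φ := continuous_abs.measurable.comp
      ((measurable_parity.comp (measurable_cut 0)).sub
        (hg.comp (measurable_localMass_degreeMeasure n)))
    have h1 : δ = ∫ m, φ m ∂(P.map M) := by
      rw [integral_map hMm.aemeasurable hφm.aestronglyMeasurable, hδ]
      refine integral_congr_ae ?_
      filter_upwards [hdeg] with ω hω
      rw [hφ]
      simp only [hω]
    have hMs : Measurable fun ω => (M ω).map (Sym2.map (fun x => x + (-(T : ℝ)))) :=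
      (Measure.measurable_map _ (measurable_sym2_shift _)).comp hMm
    rw [h1, ← hinv (-(T : ℝ)), integral_map hMs.aemeasurable hφm.aestronglyMeasurable]
    refine integral_congr_ae ?_
    filter_upwards [hdeg] with ω hω
    simp only [hφ, cut_shift, sub_neg_eq_add, zero_add]
    congr 4
    funext j
    simp only [hsh, localMass]
    split_ifs
    · rw [degreeMeasure_shift _ _ (measurableSet_cell n j), hω, preimage_add_cell]
    · rfl
  have hcutm : ∀ z, Measurable fun ω => parity (cut (M ω) z) := fun z =>
    measurable_parity.comp ((measurable_cut z).comp hMm)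
  have hgm : ∀ T, Measurable fun ω => g (sh T fun j => ξ ω (cell n j)) := fun T =>
    hg.comp ((hshm T).comp (measurable_pi_lambda _ hξc))
  have hbd : ∀ {h : Ω → ℝ} {c : ℝ}, Measurable h → (∀ ω, |h ω| ≤ c) → Integrable h P :=
    fun hm hc => Integrable.of_bound hm.aestronglyMeasurable _ (Filter.Eventually.of_forall hc)
  have hbound : ∀ T : ℕ, 2 * n ≤ T → P.real {ω | cut (M ω) 0 < ∞} ≤ 2 * δ +
      Real.exp (r * ((T - 2 * n : ℕ) : ℝ) * ((markCharFun μ Real.pi).re - 1)) := by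
    intro T hT
    -- In units of `2⁻ⁿ`, these are the points `n`, `T - n` and `T`. The windows around `0` and
    -- around `T` both miss `[n, T - n)`, so `f` below does not see the cells from `i` to `l`.
    set i : ℤ := n * 2 ^ n with hi
    set l : ℤ := (T - n) * 2 ^ n with hl
    set t : ℤ := T * 2 ^ n with ht
    have h2n : (0 : ℤ) < 2 ^ n := by positivity
    have hTn : (2 * n : ℤ) ≤ T := by exact_mod_cast hT
    have hi0 : 0 ≤ i := by positivity
    have hil : i ≤ l := by rw [hi, hl]; gcongr; linarith
    have hlt : l ≤ t := by rw [hl, ht]; gcongr; linarith [Int.natCast_nonneg n]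
    set mass : Ω → ℤ → ℝ≥0∞ := fun ω j => ξ ω (cell n j) with hmass
    set f : (ℤ → ℝ≥0∞) → ℝ := fun y => g (sh 0 y) * g (sh T y) *
      (parity (∑ j ∈ Finset.Ico 0 i, y j) * parity (∑ j ∈ Finset.Ico l t, y j)) with hf
    have hfm : Measurable f := by
      have hs : ∀ s : Finset ℤ, Measurable fun y : ℤ → ℝ≥0∞ => parity (∑ j ∈ s, y j) := fun s =>
        measurable_parity.comp (Finset.measurable_sum _ fun j _ => measurable_pi_apply j)
      exact ((hg.comp (hshm 0)).mul (hg.comp (hshm T))).mul ((hs _).mul (hs _))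
    have hmul : ∀ {a b : ℝ}, |a| ≤ 1 → |b| ≤ 1 → |a * b| ≤ 1 := by
      intro a b ha hb
      rw [abs_mul]
      exact mul_le_one₀ ha (abs_nonneg _) hb
    have hf1 : ∀ y, |f y| ≤ 1 := fun y =>
      hmul (hmul (hg1 _) (hg1 _)) (hmul (abs_parity_le _) (abs_parity_le _))
    have hdec := hξ.abs_integral_mul_parity_le hN n hil hfm hf1
    have hrestr : ∀ ω, f (fun j => if j ∈ Finset.Ico i l then 0 else ξ ω (cell n j)) =
        f (mass ω) := by
      intro ω
      have e1 : ∀ S : ℕ, (S = 0 ∨ S = T) →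
          sh S (fun j => if j ∈ Finset.Ico i l then 0 else ξ ω (cell n j)) = sh S (mass ω) := by
        intro S hS
        funext j
        simp only [hsh, hmass]
        split_ifs with h1 h2
        · exfalso
          rw [window, Finset.mem_Ico] at h1
          rw [Finset.mem_Ico] at h2
          rcases hS with rfl | rfl
          · simp only [Nat.cast_zero, zero_mul, add_zero] at h2
            linarith
          · have : l = S * 2 ^ n - i := by rw [hl, hi]; ring
            linarith
        · rfl
        · rfl
      have e2 : ∀ a b : ℤ, (b ≤ i ∨ l ≤ a) → ∑ j ∈ Finset.Ico a b,
          (if j ∈ Finset.Ico i l then 0 else ξ ω (cell n j)) = ∑ j ∈ Finset.Ico a b, mass ω j := by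
        intro a b hab
        refine Finset.sum_congr rfl fun j hj => if_neg fun hj' => ?_
        rw [Finset.mem_Ico] at hj hj'
        omega
      simp only [hf]
      rw [e1 0 (Or.inl rfl), e1 T (Or.inr rfl), e2 0 i (Or.inl le_rfl), e2 l t (Or.inr le_rfl)]
    simp_rw [hrestr] at hdec
    set w : Ω → ℝ := fun ω => parity (∑ j ∈ Finset.Ico i l, mass ω j) with hw
    have hmm : Measurable mass := measurable_pi_lambda _ hξc
    have hpm : ∀ s : Finset ℤ, Measurable fun ω => parity (∑ j ∈ s, mass ω j) := fun s =>
      measurable_parity.comp (Finset.measurable_sum _ fun j _ => hξc j)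
    have hexp : ((l - i : ℝ) / 2 ^ n) = ((T - 2 * n : ℕ) : ℝ) := by
      rw [hl, hi, Nat.cast_sub hT]
      push_cast
      field_simp
      ring
    rw [hexp] at hdec
    -- the pointwise estimate
    have hpt : ∀ᵐ ω ∂P, (if cut (M ω) 0 = ∞ then (0 : ℝ) else 1) ≤ f (mass ω) * w ω +
        (|parity (cut (M ω) 0) - g (sh 0 (mass ω))| +
          |parity (cut (M ω) T) - g (sh T (mass ω))|) := by
      filter_upwards [hM.isPointProcess.isPointMeasure, hξ.isPointProcess.isPointMeasure, hdeg]
        with ω h1 h2 h3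
      have hfin : degreeMeasure (M ω) (Set.Ico 0 (T : ℝ)) ≠ ∞ := by
        rw [h3]; exact (h2.measure_Ico_lt_top _ _).ne
      have hpar := parity_cut_mul h1 (Nat.cast_nonneg T) hfin
      rw [h3] at hpar
      have hnat : ∀ a b : ℤ, ∃ k : ℕ, ∑ j ∈ Finset.Ico a b, mass ω j = k := by
        intro a b
        simp only [hmass, ← measure_Ico_dyadic]
        exact h2.exists_nat measurableSet_Ico (h2.measure_Ico_lt_top _ _).ne
      have hsum : ξ ω (Set.Ico 0 (T : ℝ)) = ∑ j ∈ Finset.Ico 0 i, mass ω j +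
          (∑ j ∈ Finset.Ico i l, mass ω j + ∑ j ∈ Finset.Ico l t, mass ω j) := by
        have h := measure_Ico_dyadic (ξ ω) n 0 t
        have e : ((t : ℤ) : ℝ) / 2 ^ n = T := by rw [ht]; push_cast; field_simp
        rw [e, Int.cast_zero, zero_div] at h
        have hcons : ∀ {a b c : ℤ}, a ≤ b → b ≤ c → ∑ j ∈ Finset.Ico a b, mass ω j +
            ∑ j ∈ Finset.Ico b c, mass ω j = ∑ j ∈ Finset.Ico a c, mass ω j := fun hab hbc => by
          rw [← Finset.Ico_union_Ico_eq_Ico hab hbc,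
            Finset.sum_union (Finset.Ico_disjoint_Ico_consecutive _ _ _)]
        rw [h, hcons hil hlt, hcons hi0 (hil.trans hlt)]
      have hnat' : ∃ k : ℕ, ∑ j ∈ Finset.Ico i l, mass ω j + ∑ j ∈ Finset.Ico l t, mass ω j = k := by
        obtain ⟨a, ha⟩ := hnat i l
        obtain ⟨b, hb⟩ := hnat l t
        exact ⟨a + b, by rw [ha, hb]; push_cast; rfl⟩
      rw [hsum, parity_add (hnat _ _) hnat', parity_add (hnat _ _) (hnat _ _)] at hpar
      rw [← hpar]
      set x := parity (cut (M ω) 0)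
      set y := parity (cut (M ω) T)
      set q := parity (∑ j ∈ Finset.Ico 0 i, mass ω j) *
        (parity (∑ j ∈ Finset.Ico i l, mass ω j) * parity (∑ j ∈ Finset.Ico l t, mass ω j)) with hq
      have hq1 : |q| ≤ 1 := hmul (abs_parity_le _) (hmul (abs_parity_le _) (abs_parity_le _))
      have hfw : f (mass ω) * w ω = g (sh 0 (mass ω)) * g (sh T (mass ω)) * q := by
        simp only [hf, hw, hq]
        ring
      rw [hfw]
      have hy1 : |y| ≤ 1 := abs_parity_le _
      have hb1 := hg1 (sh 0 (mass ω))
      generalize g (sh 0 (mass ω)) = a at hb1 ⊢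
      generalize g (sh T (mass ω)) = b
      -- Replacing first `x` by `a`, then `y` by `b`, costs one approximation error each, since the
      -- remaining factors are bounded by `1`.
      have e : x * y * q - a * b * q = (x - a) * (y * q) + (y - b) * (a * q) := by ring
      have k1 : (x - a) * (y * q) ≤ |x - a| := by
        refine (le_abs_self _).trans ?_
        rw [abs_mul]
        exact mul_le_of_le_one_right (abs_nonneg _) (hmul hy1 hq1)
      have k2 : (y - b) * (a * q) ≤ |y - b| := by
        refine (le_abs_self _).trans ?_
        rw [abs_mul]
        exact mul_le_of_le_one_right (abs_nonneg _) (hmul hb1 hq1)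
      linarith
    have hset : MeasurableSet {ω | cut (M ω) 0 < ∞} :=
      ((measurable_cut 0).comp hMm) measurableSet_Iio
    have hlhs : P.real {ω | cut (M ω) 0 < ∞} =
        ∫ ω, (if cut (M ω) 0 = ∞ then (0 : ℝ) else 1) ∂P := by
      rw [← integral_indicator_one hset]
      congr with ω
      by_cases h : cut (M ω) 0 = ∞ <;> simp [h, lt_top_iff_ne_top]
    have hI1 : Integrable (fun ω => f (mass ω) * w ω) P :=
      hbd ((hfm.comp hmm).mul (hpm _)) fun ω => hmul (hf1 _) (abs_parity_le _)
    have hI2 : ∀ S : ℕ, Integrable (fun ω => |parity (cut (M ω) S) - g (sh S (mass ω))|) P := by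
      intro S
      refine hbd (c := 2) (continuous_abs.measurable.comp ((hcutm S).sub (hgm S))) fun ω => ?_
      rw [abs_abs]
      exact (abs_sub _ _).trans (by linarith [abs_parity_le (cut (M ω) S), hg1 (sh S (mass ω))])
    have hI0 := hI2 0
    rw [Nat.cast_zero] at hI0
    have hsh' : ∫ ω, |parity (cut (M ω) 0) - g (sh 0 (mass ω))| ∂P = δ := by
      have := hshift 0
      rwa [Nat.cast_zero] at this
    rw [hlhs]
    refine (integral_mono_of_nonneg (Filter.Eventually.of_forall fun ω => by
      simp only [Pi.zero_apply]; split_ifs <;> norm_num) (hI1.add (hI0.add (hI2 T))) hpt).trans ?_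
    rw [integral_add' hI1 (hI0.add (hI2 T)), integral_add' hI0 (hI2 T), hsh', hshift T]
    linarith [(le_abs_self _).trans hdec]
  have hre := re_markCharFun_pi_lt_one hμ
  have hlim : Filter.Tendsto (fun k : ℕ => 2 * δ +
      Real.exp (r * (k : ℝ) * ((markCharFun μ Real.pi).re - 1))) Filter.atTop (nhds (2 * δ)) := by
    have hneg : (r : ℝ) * ((markCharFun μ Real.pi).re - 1) < 0 :=
      mul_neg_of_pos_of_neg (by exact_mod_cast hr) (by linarith)
    have h1 : Filter.Tendsto (fun k : ℕ => (k : ℝ) * (r * ((markCharFun μ Real.pi).re - 1)))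
        Filter.atTop Filter.atBot := tendsto_natCast_atTop_atTop.atTop_mul_const_of_neg hneg
    have h2 := (Real.tendsto_exp_atBot.comp h1).const_add (2 * δ)
    rw [add_zero] at h2
    refine h2.congr fun k => ?_
    simp only [Function.comp_apply]
    congr 2
    ring
  -- Here `T = 2 * n + k` tends to infinity while `n`, and hence `δ`, stays fixed.
  refine ge_of_tendsto' hlim fun k => ?_
  have := hbound (2 * n + k) (by omega)
  rwa [Nat.add_sub_cancel_left] at this

theorem ae_cut_eq_top (hr : 0 < r) (hμ : ∃ k : ℕ, Odd k ∧ 0 < μ {k})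
    (hN : IsPoissonProcess r N P) (hξ : IsIIDMarking μ N ξ P) (hM : IsMatchingScheme N ξ M P)
    (hinv : IsTranslationInvariant M P) (hfac : IsFactor N ξ M P) :
    ∀ᵐ ω ∂P, cut (M ω) 0 = ∞ := by
  obtain ⟨F, hF, hMF⟩ := hfac
  obtain ⟨g, hgm, hg1, hlim⟩ := hξ.exists_tendsto_localMass hN
    (f := fun p => parity (cut (F p) 0)) (measurable_parity.comp ((measurable_cut 0).comp hF))
    (fun p => abs_parity_le _)
  have hle : P.real {ω | cut (M ω) 0 < ∞} ≤ 0 := by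
    refine ge_of_tendsto' (by simpa using hlim.const_mul 2) fun n => ?_
    refine (measureReal_cut_le hr hμ hN hξ hM hinv n (hgm n) (hg1 n)).trans (le_of_eq ?_)
    congr 1
    refine integral_congr_ae ?_
    filter_upwards [hMF] with ω hω
    rw [hω]
  have h0 : P {ω | cut (M ω) 0 < ∞} = 0 :=
    (measureReal_eq_zero_iff).1 (le_antisymm hle measureReal_nonneg)
  rw [ae_iff]
  simpa [lt_top_iff_ne_top] using h0

end Cut

end PoissonMatching

theorem proposition1p6 {Ω : Type*} [MeasurableSpace Ω] (P : Measure Ω) [IsProbabilityMeasure P]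
    (r : ℝ≥0) (hr : 0 < r)
    (μ : Measure ℕ) [IsProbabilityMeasure μ] (hμ_pos : μ {0} = 0)
    (hμ_odd : ∃ k : ℕ, Odd k ∧ 0 < μ {k})
    (N ξ : Ω → Measure ℝ) (M : Ω → Measure (Sym2 ℝ))
    (hN : PoissonMatching.IsPoissonProcess r N P)
    (hξ : PoissonMatching.IsIIDMarking μ N ξ P)
    (hM : PoissonMatching.IsMatchingScheme N ξ M P)
    (hM_simple : PoissonMatching.IsSimple M P)
    (hM_inv : PoissonMatching.IsTranslationInvariant M P)
    (hM_factor : PoissonMatching.IsFactor N ξ M P) :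
    ∀ᵐ ω ∂P,
      {e | e ∈ PoissonMatching.points (M ω) ∧ PoissonMatching.Crosses e 0}.Infinite := by
  filter_upwards [PoissonMatching.ae_cut_eq_top hr hμ_odd hN hξ hM hM_inv hM_factor,
    hM.isPointProcess.isPointMeasure, hξ.isPointProcess.isPointMeasure, hM.ae_degreeMeasure_eq hξ]
    with ω h1 h2 h3 h4 hfin
  -- Finitely many crossing edges and the finite degree at `0` would make the cut finite.
  refine (PoissonMatching.cut_lt_top_of_finite h2 ?_ hfin).ne h1
  obtain ⟨k, hk⟩ := h3 {0} (measurableSet_singleton _) {0} isCompact_singleton subset_rfl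
  rw [h4, hk]
  exact ENNReal.natCast_ne_top k
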